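/- Identify $\mathbb R^4$ with the quaternions $\mathbb H$ through the basis $1,\mathbf i,\mathbf j,\mathbf k$ and $\mathbb R^3$ with the imaginary quaternions through $\mathbf i,\mathbf j,\mathbf k$, let $\mathbb S^3\subset\mathbb H$ be the group of unit quaternions, and let $\Pi_3:\mathbb S^3\to\mathrm{SO}_3$, $\Pi_3(z)h=zh\bar z$, and $\Pi_4:\mathbb S^3\times\mathbb S^3\to\mathrm{SO}_4$, $\Pi_4(z_l,z_r)q=z_lq\bar z_r$, be the spin double covers. For $n=2,3$, a smooth curve $\gamma:[0,1]\to\mathbb S^n$ is called generic if $\gamma(t),\gamma'(t),\dots,\gamma^{(n-1)}(t)$ are linearly independent for all $t\in[0,1]$, and locally convex if $\det(\gamma(t),\gamma'(t),\dots,\gamma^{(n)}(t))>0$ for all $t\in[0,1]$. The Frenet frame $\mathcal F_\gamma(t)\in\mathrm{SO}_{n+1}$ of a generic curve is the matrix whose first $n$ columns are obtained by Gram–Schmidt orthonormalization from $\gamma(t),\dots,\gamma^{(n-1)}(t)$, the last column completing them to a positive orthonormal basis. If $\mathcal F_\gamma(0)=I$, let $\tilde{\mathcal F}_\gamma$ be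 the unique continuous lift of $\mathcal F_\gamma$ through $\Pi_{n+1}$ that starts at the identity. Let $\mathcal G\mathbb S^n(z)$ (respectively $\mathcal L\mathbb S^n(z)$) be the space of smooth generic (respectively locally convex) curves $\gamma:[0,1]\to\mathbb S^n$ with $\mathcal F_\gamma(0)=I$ and $\tilde{\mathcal F}_\gamma(1)=z$, with the $C^\infty$ topology (uniform convergence of all derivatives on $[0,1]$). For an immersed curve $\gamma$ in $\mathbb S^2$ put $\mathbf t_\gamma=\gamma'/\|\gamma'\|$, $\mathbf n_\gamma=\gamma\times\mathbf t_\gamma$, and let $\kappa_\gamma=(\mathbf t_\gamma'\cdot\mathbf n_\gamma)/\|\gamma'\|$ be its geodesic curvature. **Theorem.** For all $z_l,z_r\in\mathbb S^3$ there is a homeomorphism $\gamma\mapsto(\gamma_l,\gamma_r)$ from $\mathcal L\mathbb S^3(z_l,z_r)$ onto the space of pairs of curves $(\gamma_l,\gamma_r)\in\mathcal L\mathbb S^2(z_l)\times\mathcal G\mathbb S^2(z_r)$ such that $$\|\gamma_l'(t)\|=\|\gamma_r'(t)\|,\qquad \kappa_{\gamma_l}(t)>|\kappa_{\gamma_r}(t)|,\qquad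 t\in[0,1],$$ and it is given by the decomposition of the lifted Frenet frame: $\tilde{\mathcal F}_\gamma(t)=(\tilde{\mathcal F}_{\gamma_l}(t),\tilde{\mathcal F}_{\gamma_r}(t))$ for all $t\in[0,1]$. -/

import Mathlib

open scoped ContDiff Quaternion

noncomputable section

/-- The unit sphere `𝕊ⁿ` of the Euclidean space `ℝⁿ⁺¹`. -/
abbrev SphereN (n : ℕ) : Type := Metric.sphere (0 : EuclideanSpace ℝ (Fin (n + 1))) 1

/-- The group `𝕊³` of unit quaternions. -/
abbrev UnitQuaternion : Type := Metric.sphere (0 : ℍ[ℝ]) 1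

/-- Smooth (`C^∞`) curves `γ : [0,1] → 𝕊ⁿ`. Smoothness is that of the map into `ℝⁿ⁺¹` on the closed
interval, with one-sided derivatives at the endpoints. -/
@[ext]
structure SphereCurve (n : ℕ) where
  /-- The underlying map. -/
  toFun : unitInterval → SphereN n
  smooth : ContDiffOn ℝ ∞
    (Set.IccExtend (zero_le_one' ℝ) fun t => (toFun t : EuclideanSpace ℝ (Fin (n + 1))))
    (Set.Icc 0 1)

namespace SphereCurve

variable {n : ℕ}

/-- The curve as a map of a real variable with values in `ℝⁿ⁺¹`; only its restriction to `[0,1]` is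
used. -/
def extend (γ : SphereCurve n) : ℝ → EuclideanSpace ℝ (Fin (n + 1)) :=
  Set.IccExtend (zero_le_one' ℝ) fun t => (γ.toFun t : EuclideanSpace ℝ (Fin (n + 1)))

/-- The `k`-th derivative `γ⁽ᵏ⁾(t)`, `t ∈ [0,1]` (one-sided at the endpoints). -/
def der (γ : SphereCurve n) (k : ℕ) (t : ℝ) : EuclideanSpace ℝ (Fin (n + 1)) :=
  iteratedDerivWithin k γ.extend (Set.Icc 0 1) t

/-- The `C^∞` topology: uniform convergence on `[0,1]` of the curves and of all their
derivatives. -/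
instance : TopologicalSpace (SphereCurve n) :=
  TopologicalSpace.induced
    (fun γ (k : ℕ) => UniformFun.ofFun fun t : unitInterval => γ.der k t)
    (inferInstance : TopologicalSpace
      (ℕ → UniformFun unitInterval (EuclideanSpace ℝ (Fin (n + 1)))))

/-- `γ` is generic: `γ(t), γ'(t), …, γ⁽ⁿ⁻¹⁾(t)` are linearly independent for all `t`. -/
def IsGeneric (γ : SphereCurve n) : Prop :=
  ∀ t : unitInterval, LinearIndependent ℝ fun k : Fin n => γ.der k t

/-- `γ` is locally convex: `det (γ(t), γ'(t), …, γ⁽ⁿ⁾(t)) > 0` for all `t`. -/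
def IsLocallyConvex (γ : SphereCurve n) : Prop :=
  ∀ t : unitInterval, 0 < (Matrix.of fun i k : Fin (n + 1) => γ.der k t i).det

/-- `F` is the Frenet frame curve of the generic curve `γ`: the first `n` columns of `F t` are
obtained from `γ(t), γ'(t), …, γ⁽ⁿ⁻¹⁾(t)` by Gram-Schmidt orthonormalization, and the last column
completes them to a positive orthonormal basis. -/
def IsFrenetFrame (γ : SphereCurve n)
    (F : unitInterval → Matrix (Fin (n + 1)) (Fin (n + 1)) ℝ) : Prop :=
  ∀ t : unitInterval, F t ∈ Matrix.specialOrthogonalGroup (Fin (n + 1)) ℝ ∧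
    ∀ (i : Fin (n + 1)) (j : Fin n),
      F t i j.castSucc =
        InnerProductSpace.gramSchmidtNormed ℝ (fun k : Fin n => γ.der k t) j i

/-- For a projection `P` of the spin group `S` to the matrices, `Γ` is the lifted Frenet frame curve
of `γ`: it is continuous, starts at the identity, and projects to the Frenet frame curve of `γ`. -/
def IsLiftedFrame {S : Type} [TopologicalSpace S] [One S]
    (P : S → Matrix (Fin (n + 1)) (Fin (n + 1)) ℝ) (γ : SphereCurve n) (Γ : unitInterval → S) :
    Prop :=
  Continuous Γ ∧ Γ 0 = 1 ∧ γ.IsFrenetFrame fun t => P (Γ t)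

/-- The set of generic curves whose lifted Frenet frame curve goes from the identity to `z`. -/
def genericSpace {S : Type} [TopologicalSpace S] [One S]
    (P : S → Matrix (Fin (n + 1)) (Fin (n + 1)) ℝ) (z : S) : Set (SphereCurve n) :=
  {γ | γ.IsGeneric ∧ ∃ Γ : unitInterval → S, IsLiftedFrame P γ Γ ∧ Γ 1 = z}

/-- The set of locally convex curves whose lifted Frenet frame curve goes from the identity
to `z`. -/
def locallyConvexSpace {S : Type} [TopologicalSpace S] [One S]
    (P : S → Matrix (Fin (n + 1)) (Fin (n + 1)) ℝ) (z : S) : Set (SphereCurve n) :=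
  {γ | γ.IsLocallyConvex ∧ ∃ Γ : unitInterval → S, IsLiftedFrame P γ Γ ∧ Γ 1 = z}

/-- The unit tangent vector `γ'(t) / ‖γ'(t)‖`. -/
def tangent (γ : SphereCurve n) (t : ℝ) : EuclideanSpace ℝ (Fin (n + 1)) :=
  ‖γ.der 1 t‖⁻¹ • γ.der 1 t

/-- The unit normal vector `γ(t) × 𝐭(t)` of a curve in `𝕊²`. -/
def normal (γ : SphereCurve 2) (t : ℝ) : EuclideanSpace ℝ (Fin 3) :=
  WithLp.toLp 2 (crossProduct (γ.extend t).ofLp (γ.tangent t).ofLp)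

/-- The geodesic curvature `(𝐭'(t) ⬝ 𝐧(t)) / ‖γ'(t)‖` of a curve in `𝕊²`. -/
def geodesicCurvature (γ : SphereCurve 2) (t : ℝ) : ℝ :=
  inner ℝ (derivWithin γ.tangent (Set.Icc 0 1) t) (γ.normal t) / ‖γ.der 1 t‖

end SphereCurve

/-- The basis `1, 𝐢, 𝐣, 𝐤` of the quaternions, which identifies them with `ℝ⁴`. -/
def quaternionBasis : Fin 4 → ℍ[ℝ] := ![⟨1, 0, 0, 0⟩, ⟨0, 1, 0, 0⟩, ⟨0, 0, 1, 0⟩, ⟨0, 0, 0, 1⟩]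

/-- The coordinates of a quaternion in the basis `1, 𝐢, 𝐣, 𝐤`. -/
def quaternionCoord (q : ℍ[ℝ]) : Fin 4 → ℝ := ![q.re, q.imI, q.imJ, q.imK]

/-- The projection `Π₃ : 𝕊³ → SO₃`: the matrix of `h ↦ z h z̄` on the imaginary quaternions, in the
basis `𝐢, 𝐣, 𝐤`. -/
def spinProj3 (z : UnitQuaternion) : Matrix (Fin 3) (Fin 3) ℝ :=
  Matrix.of fun i j =>
    quaternionCoord ((z : ℍ[ℝ]) * quaternionBasis j.succ * star (z : ℍ[ℝ])) i.succ

/-- The projection `Π₄ : 𝕊³ × 𝕊³ → SO₄`: the matrix of `q ↦ z_l q z̄_r` on the quaternions, in the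
basis `1, 𝐢, 𝐣, 𝐤`. -/
def spinProj4 (z : UnitQuaternion × UnitQuaternion) : Matrix (Fin 4) (Fin 4) ℝ :=
  Matrix.of fun i j =>
    quaternionCoord ((z.1 : ℍ[ℝ]) * quaternionBasis j * star (z.2 : ℍ[ℝ])) i

/-- `𝓖𝕊²(z)`, with the subspace topology. -/
abbrev GS2 (z : UnitQuaternion) : Set (SphereCurve 2) := SphereCurve.genericSpace spinProj3 z

/-- `𝓛𝕊²(z)`, with the subspace topology. -/
abbrev LS2 (z : UnitQuaternion) : Set (SphereCurve 2) := SphereCurve.locallyConvexSpace spinProj3 z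

/-- `𝓛𝕊³(z_l, z_r)`, with the subspace topology. -/
abbrev LS3 (zl zr : UnitQuaternion) : Set (SphereCurve 3) :=
  SphereCurve.locallyConvexSpace spinProj4 (zl, zr)

/-- The pairs `(γ_l, γ_r) ∈ 𝓛𝕊²(z_l) × 𝓖𝕊²(z_r)` with `‖γ_l'‖ = ‖γ_r'‖` and `κ_{γ_l} > |κ_{γ_r}|`
on `[0,1]`, with the subspace topology. -/
def curvePairs (zl zr : UnitQuaternion) : Set (SphereCurve 2 × SphereCurve 2) :=
  {p | p.1 ∈ LS2 zl ∧ p.2 ∈ GS2 zr ∧ ∀ t : unitInterval,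
    ‖p.1.der 1 t‖ = ‖p.2.der 1 t‖ ∧ p.1.geodesicCurvature t > |p.2.geodesicCurvature t|}

end

/-!
Let `γ` be a locally convex curve in `𝕊³` with lifted Frenet frame `(z, w)`, so that
`γ = z w̄`, `𝐭 = z 𝐢 w̄`, `𝐧 = z 𝐣 w̄` and `𝐛 = z 𝐤 w̄`. Write `z' = z α` and `w' = w β` with imaginary
quaternions `α` and `β`. The condition that the derivative of the frame is tridiagonal with positive
subdiagonal entries says exactly that `α = a 𝐢 + c 𝐤` and `β = a' 𝐢 + c 𝐤` with `c > 0` and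
`a > |a'|` (`SphereCurve.frenet_iff_of_isSpinCurve_pair` and `SphereCurve.isLocallyConvex_iff`; the
inequality `a > a'` is `‖γ'‖ > 0` and `a + a' > 0` is the positivity of the torsion). In the same
way, `z` is the lifted Frenet frame of the curve `γ_l = z 𝐢 z̄` in `𝕊²` if and only if
`α = a 𝐢 + c 𝐤` with `c > 0`, and then `γ_l` has speed `2 c` and geodesic curvature `a / c`
(`SphereCurve.frenet_iff_of_isSpinCurve`, `SphereCurve.speed_tangent_of_isSpinCurve`). Hence the
frames of locally convex curves in `𝕊³` are the pairs of frames of curves `γ_l`, `γ_r` with equal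
speeds and with `κ_l > |κ_r|` (`exists_pair`, `exists_curve`). To differentiate a lifted frame, which
is only known to be continuous, one uses that `4 Re(u) u`, for `u = z z̄(t₀)`, is a polynomial in the
entries of its projection (`Quaternion.sum_mul_star`, `differentiableOn_of_mul_mul_star`). The same
identity shows that lifts are unique (`eq_of_mul_quaternionBasis_eq`).

The bijection is continuous because `γ_l = 𝐭 γ̄` and `γ_r = γ̄ 𝐭` are differential expressions in `γ`.
Its inverse is continuous because `γ` is the solution of the linear equation `γ' = (a - a') γ_l γ`,
`γ(0) = 1`, where `2 a` and `2 a'` are the rates of rotation of the tangents of `γ_l` and `γ_r`: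
for two unit solutions `q₀`, `q` of such equations, `q̄₀ q` has derivative `q̄₀ (A - A₀) q`, which gives
uniform continuity of `γ` in the coefficients (`continuous_of_linear_ode`), and the equation then
gives the continuity of all derivatives. Continuity for the `C^∞` topology is handled throughout as
joint continuity of all derivatives in the parameter and in `t` (`IsSmoothFamily`).
-/

noncomputable section

/-! ### Families of smooth curves depending continuously on a parameter -/

section SmoothFamily

open Set

variable {X Y E F G : Type*} [TopologicalSpace X] [TopologicalSpace Y]
  [NormedAddCommGroup E] [NormedSpace ℝ E] [NormedAddCommGroup F] [NormedSpace ℝ F]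
  [NormedAddCommGroup G] [NormedSpace ℝ G]

/-- The family `f x : ℝ → E` of curves, of which only the restrictions to `[0,1]` matter, is `n` times
differentiable in `t`, and these derivatives are jointly continuous in the parameter `x` and in
`t ∈ [0,1]`. -/
def IsFamilyC : ℕ → (X → ℝ → E) → Prop
  | 0, f => Continuous fun p : X × unitInterval => f p.1 p.2
  | n + 1, f => (Continuous fun p : X × unitInterval => f p.1 p.2) ∧
      ∃ f' : X → ℝ → E, (∀ x, ∀ t ∈ Icc (0 : ℝ) 1, HasDerivWithinAt (f x) (f' x t) (Icc 0 1) t) ∧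
        IsFamilyC n f'

/-- The family `f x` of curves on `[0,1]` is smooth in `t`, with all derivatives jointly continuous
in `(x, t)`. As `[0,1]` is compact, this says that `x ↦ f x` is continuous for the `C^∞` topology. -/
def IsSmoothFamily (f : X → ℝ → E) : Prop := ∀ n, IsFamilyC n f

namespace IsFamilyC

theorem continuous {n : ℕ} {f : X → ℝ → E} (hf : IsFamilyC n f) :
    Continuous fun p : X × unitInterval => f p.1 p.2 := by
  cases n with
  | zero => exact hf
  | succ n => exact hf.1

theorem of_succ {n : ℕ} {f : X → ℝ → E} (hf : IsFamilyC (n + 1) f) : IsFamilyC n f := by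
  induction n generalizing f with
  | zero => exact hf.1
  | succ n ih =>
    obtain ⟨hc, f', hd, hf'⟩ := hf
    exact ⟨hc, f', hd, ih hf'⟩

theorem congr {n : ℕ} {f g : X → ℝ → E} (hf : IsFamilyC n f)
    (h : ∀ x, ∀ t ∈ Icc (0 : ℝ) 1, g x t = f x t) : IsFamilyC n g := by
  have hc : Continuous fun p : X × unitInterval => g p.1 p.2 :=
    hf.continuous.congr fun p => (h p.1 p.2 p.2.2).symm
  cases n with
  | zero => exact hc
  | succ n =>
    obtain ⟨_, f', hd, hf'⟩ := hf
    exact ⟨hc, f', fun x t ht => (hd x t ht).congr (h x) (h x t ht), hf'⟩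

theorem comp {n : ℕ} {f : X → ℝ → E} (hf : IsFamilyC n f) {φ : Y → X} (hφ : Continuous φ) :
    IsFamilyC n fun y => f (φ y) := by
  induction n generalizing f with
  | zero => exact Continuous.comp hf (hφ.prodMap continuous_id)
  | succ n ih =>
    obtain ⟨hc, f', hd, hf'⟩ := hf
    exact ⟨hc.comp (hφ.prodMap continuous_id), fun y => f' (φ y), fun y => hd (φ y), ih hf'⟩

theorem clm {n : ℕ} {f : X → ℝ → E} (hf : IsFamilyC n f) (L : E →L[ℝ] F) :
    IsFamilyC n fun x t => L (f x t) := by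
  induction n generalizing f with
  | zero => exact L.continuous.comp hf
  | succ n ih =>
    obtain ⟨hc, f', hd, hf'⟩ := hf
    exact ⟨L.continuous.comp hc, fun x t => L (f' x t),
      fun x t ht => L.hasFDerivAt.comp_hasDerivWithinAt t (hd x t ht), ih hf'⟩

theorem add {n : ℕ} {f g : X → ℝ → E} (hf : IsFamilyC n f) (hg : IsFamilyC n g) :
    IsFamilyC n fun x t => f x t + g x t := by
  induction n generalizing f g with
  | zero => exact Continuous.add hf hg
  | succ n ih =>
    obtain ⟨hc, f', hd, hf'⟩ := hf
    obtain ⟨hc₂, g', hd₂, hg'⟩ := hg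
    exact ⟨hc.add hc₂, fun x t => f' x t + g' x t,
      fun x t ht => (hd x t ht).add (hd₂ x t ht), ih hf' hg'⟩

theorem bilin {n : ℕ} {f : X → ℝ → E} {g : X → ℝ → F} (hf : IsFamilyC n f) (hg : IsFamilyC n g)
    (B : E →L[ℝ] F →L[ℝ] G) : IsFamilyC n fun x t => B (f x t) (g x t) := by
  induction n generalizing f g with
  | zero => exact B.continuous₂.comp (Continuous.prodMk hf hg)
  | succ n ih =>
    have hf₀ := hf.of_succ
    have hg₀ := hg.of_succ
    obtain ⟨hc, f', hd, hf'⟩ := hf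
    obtain ⟨hc₂, g', hd₂, hg'⟩ := hg
    exact ⟨B.continuous₂.comp (Continuous.prodMk hc hc₂), _,
      fun x t ht => ContinuousLinearMap.hasDerivWithinAt_of_bilinear (hd x t ht) (hd₂ x t ht),
      (ih hf₀ hg').add (ih hf' hg₀)⟩

theorem mul {n : ℕ} {A : Type*} [NormedRing A] [NormedAlgebra ℝ A] {f g : X → ℝ → A}
    (hf : IsFamilyC n f) (hg : IsFamilyC n g) : IsFamilyC n fun x t => f x t * g x t :=
  hf.bilin hg (ContinuousLinearMap.mul ℝ A)

theorem inv {n : ℕ} {f : X → ℝ → ℝ} (hf : IsFamilyC n f)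
    (h₀ : ∀ x, ∀ t ∈ Icc (0 : ℝ) 1, f x t ≠ 0) : IsFamilyC n fun x t => (f x t)⁻¹ := by
  induction n with
  | zero => exact Continuous.inv₀ hf fun p => h₀ p.1 p.2 p.2.2
  | succ n ih =>
    have hi := ih hf.of_succ
    obtain ⟨hc, f', hd, hf'⟩ := hf
    refine ⟨hc.inv₀ fun p => h₀ p.1 p.2 p.2.2, fun x t => -f' x t * ((f x t)⁻¹ * (f x t)⁻¹),
      fun x t ht => ?_, ?_⟩
    · exact ((hd x t ht).fun_inv (h₀ x t ht)).congr_deriv (by rw [div_eq_mul_inv, sq, mul_inv])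
    · exact (hf'.clm (-ContinuousLinearMap.id ℝ ℝ)).mul (hi.mul hi)

theorem sqrt {n : ℕ} {f : X → ℝ → ℝ} (hf : IsFamilyC n f)
    (h₀ : ∀ x, ∀ t ∈ Icc (0 : ℝ) 1, 0 < f x t) : IsFamilyC n fun x t => √(f x t) := by
  induction n with
  | zero => exact Real.continuous_sqrt.comp hf
  | succ n ih =>
    have hi := ih hf.of_succ
    obtain ⟨hc, f', hd, hf'⟩ := hf
    refine ⟨Real.continuous_sqrt.comp hc, fun x t => f' x t * ((2 : ℝ) • √(f x t))⁻¹,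
      fun x t ht => ?_, ?_⟩
    · exact ((hd x t ht).sqrt (h₀ x t ht).ne').congr_deriv (div_eq_mul_inv _ _)
    · exact hf'.mul ((hi.clm ((2 : ℝ) • ContinuousLinearMap.id ℝ ℝ)).inv fun x t ht =>
        mul_ne_zero two_ne_zero (Real.sqrt_pos.2 (h₀ x t ht)).ne')

end IsFamilyC

/-- Uniform convergence of a family of continuous functions on `[0,1]` is joint continuity. -/
theorem continuous_ofFun_iff {E : Type*} [NormedAddCommGroup E] {g : X → unitInterval → E} (hg : ∀ x, Continuous (g x)) :
    (Continuous fun x => UniformFun.ofFun (g x)) ↔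
      Continuous fun p : X × unitInterval => g p.1 p.2 := by
  have key : (Continuous fun x => UniformFun.ofFun (g x)) ↔
      Continuous fun x => (⟨g x, hg x⟩ : C(unitInterval, E)) := by
    simp only [continuous_iff_continuousAt, ContinuousAt,
      ContinuousMap.tendsto_iff_tendstoUniformly, UniformFun.tendsto_iff_tendstoUniformly]
    rfl
  rw [key]
  constructor
  · intro h
    exact ContinuousMap.continuous_uncurry_of_continuous ⟨_, h⟩
  · intro h
    exact (ContinuousMap.curry ⟨_, h⟩).continuous

namespace IsSmoothFamily

theorem continuous {f : X → ℝ → E} (hf : IsSmoothFamily f) :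
    Continuous fun p : X × unitInterval => f p.1 p.2 := (hf 0).continuous

theorem hasDerivWithinAt {f : X → ℝ → E} (hf : IsSmoothFamily f) (x : X) {t : ℝ}
    (ht : t ∈ Icc (0 : ℝ) 1) :
    HasDerivWithinAt (f x) (derivWithin (f x) (Icc 0 1) t) (Icc 0 1) t := by
  obtain ⟨_, f', hd, _⟩ := hf 1
  exact (hd x t ht).differentiableWithinAt.hasDerivWithinAt

protected theorem derivWithin {f : X → ℝ → E} (hf : IsSmoothFamily f) :
    IsSmoothFamily fun x => derivWithin (f x) (Icc 0 1) := fun n => by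
  obtain ⟨_, f', hd, hf'⟩ := hf (n + 1)
  exact hf'.congr fun x t ht =>
    (hd x t ht).derivWithin (uniqueDiffOn_Icc zero_lt_one t ht)

theorem congr {f g : X → ℝ → E} (hf : IsSmoothFamily f)
    (h : ∀ x, ∀ t ∈ Icc (0 : ℝ) 1, g x t = f x t) : IsSmoothFamily g :=
  fun n => (hf n).congr h

theorem comp {f : X → ℝ → E} (hf : IsSmoothFamily f) {φ : Y → X} (hφ : Continuous φ) :
    IsSmoothFamily fun y => f (φ y) := fun n => (hf n).comp hφ

theorem clm {f : X → ℝ → E} (hf : IsSmoothFamily f) (L : E →L[ℝ] F) :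
    IsSmoothFamily fun x t => L (f x t) := fun n => (hf n).clm L

theorem add {f g : X → ℝ → E} (hf : IsSmoothFamily f) (hg : IsSmoothFamily g) :
    IsSmoothFamily fun x t => f x t + g x t := fun n => (hf n).add (hg n)

theorem bilin {f : X → ℝ → E} {g : X → ℝ → F} (hf : IsSmoothFamily f) (hg : IsSmoothFamily g)
    (B : E →L[ℝ] F →L[ℝ] G) : IsSmoothFamily fun x t => B (f x t) (g x t) :=
  fun n => (hf n).bilin (hg n) B

theorem mul {A : Type*} [NormedRing A] [NormedAlgebra ℝ A] {f g : X → ℝ → A}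
    (hf : IsSmoothFamily f) (hg : IsSmoothFamily g) : IsSmoothFamily fun x t => f x t * g x t :=
  fun n => (hf n).mul (hg n)

theorem smul {f : X → ℝ → ℝ} {g : X → ℝ → E} (hf : IsSmoothFamily f) (hg : IsSmoothFamily g) :
    IsSmoothFamily fun x t => f x t • g x t :=
  hf.bilin hg (ContinuousLinearMap.lsmul ℝ ℝ)

theorem inv {f : X → ℝ → ℝ} (hf : IsSmoothFamily f)
    (h₀ : ∀ x, ∀ t ∈ Icc (0 : ℝ) 1, f x t ≠ 0) : IsSmoothFamily fun x t => (f x t)⁻¹ :=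
  fun n => (hf n).inv h₀

theorem norm {E : Type*} [NormedAddCommGroup E] [InnerProductSpace ℝ E] {f : X → ℝ → E}
    (hf : IsSmoothFamily f) (h₀ : ∀ x, ∀ t ∈ Icc (0 : ℝ) 1, f x t ≠ 0) :
    IsSmoothFamily fun x t => ‖f x t‖ := by
  have h : IsSmoothFamily fun x t => √(inner ℝ (f x t) (f x t)) := fun n =>
    ((hf n).bilin (hf n) (innerSL ℝ)).sqrt fun x t ht => real_inner_self_pos.2 (h₀ x t ht)
  exact h.congr fun x t _ => norm_eq_sqrt_real_inner _

theorem normalize {E : Type*} [NormedAddCommGroup E] [InnerProductSpace ℝ E] {f : X → ℝ → E}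
    (hf : IsSmoothFamily f) (h₀ : ∀ x, ∀ t ∈ Icc (0 : ℝ) 1, f x t ≠ 0) :
    IsSmoothFamily fun x t => ‖f x t‖⁻¹ • f x t :=
  ((hf.norm h₀).inv fun x t ht => norm_ne_zero_iff.2 (h₀ x t ht)).smul hf

theorem iteratedDerivWithin {f : X → ℝ → E} (hf : IsSmoothFamily f) (k : ℕ) :
    IsSmoothFamily fun x => iteratedDerivWithin k (f x) (Icc 0 1) := by
  induction k with
  | zero => simpa using hf
  | succ k ih => simpa [iteratedDerivWithin_succ] using ih.derivWithin

theorem contDiffOn {f : X → ℝ → E} (hf : IsSmoothFamily f) (x : X) :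
    ContDiffOn ℝ ∞ (f x) (Icc 0 1) := by
  have h := contDiffOn_of_differentiableOn_deriv (𝕜 := ℝ) (f := f x) (s := Icc 0 1) (n := ⊤)
    fun m _ t ht => ((hf.iteratedDerivWithin m).hasDerivWithinAt x ht).differentiableWithinAt
  exact h

theorem of_contDiffOn {f : X → ℝ → E} (hf : ∀ x, ContDiffOn ℝ ∞ (f x) (Icc 0 1))
    (hc : ∀ k, Continuous fun p : X × unitInterval =>
      _root_.iteratedDerivWithin k (f p.1) (Icc 0 1) p.2) : IsSmoothFamily f := by
  intro n
  induction n generalizing f with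
  | zero => exact (hc 0).congr fun p => by simp
  | succ n ih =>
    refine ⟨by simpa using hc 0, fun x => _root_.derivWithin (f x) (Icc 0 1), fun x t ht => ?_,
      ih (fun x => ?_) fun k => ?_⟩
    · exact ((hf x).differentiableOn (by simp) t ht).hasDerivWithinAt
    · exact ((contDiffOn_infty_iff_derivWithin (uniqueDiffOn_Icc zero_lt_one)).1 (hf x)).2
    · simpa [iteratedDerivWithin_succ'] using hc (k + 1)

/-- Solutions of a linear differential equation with smoothly varying coefficients vary smoothly as
soon as they vary continuously. -/
theorem of_linear_ode {A : Type*} [NormedRing A] [NormedAlgebra ℝ A] {a f : X → ℝ → A}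
    (ha : IsSmoothFamily a) (hf : Continuous fun p : X × unitInterval => f p.1 p.2)
    (hd : ∀ x, ∀ t ∈ Icc (0 : ℝ) 1, HasDerivWithinAt (f x) (a x t * f x t) (Icc 0 1) t) :
    IsSmoothFamily f := by
  intro n
  induction n with
  | zero => exact hf
  | succ n ih => exact ⟨hf, _, hd, (ha n).mul ih⟩

end IsSmoothFamily

end SmoothFamily

namespace SphereCurve

open Set

variable {n : ℕ} {X : Type*} [TopologicalSpace X]

/-- A family of spherical curves is continuous for the `C^∞` topology if and only if all derivatives
are jointly continuous. -/
theorem continuous_iff_isSmoothFamily {γ : X → SphereCurve n} :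
    Continuous γ ↔ IsSmoothFamily fun x => (γ x).extend := by
  have hu : UniqueDiffOn ℝ (Icc (0 : ℝ) 1) := uniqueDiffOn_Icc zero_lt_one
  have hk : ∀ k x, Continuous fun t : unitInterval => (γ x).der k t := fun k x =>
    continuousOn_iff_continuous_domRestrict.1
      ((γ x).smooth.continuousOn_iteratedDerivWithin (by exact_mod_cast le_top) hu)
  have h : Continuous γ ↔ ∀ k, Continuous fun p : X × unitInterval => (γ p.1).der k p.2 := by
    rw [continuous_induced_rng, continuous_pi_iff]
    exact forall_congr' fun k => continuous_ofFun_iff (hk k)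
  rw [h]
  exact ⟨fun h => .of_contDiffOn (fun x => (γ x).smooth) h,
    fun h k => (h.iteratedDerivWithin k).continuous⟩

/-- The derivatives of the curves themselves, as a smooth family over the space of curves. -/
theorem isSmoothFamily_der (k : ℕ) : IsSmoothFamily fun (γ : SphereCurve n) => γ.der k :=
  (continuous_iff_isSmoothFamily.1 continuous_id).iteratedDerivWithin k

theorem der_zero (γ : SphereCurve n) : γ.der 0 = γ.extend := iteratedDerivWithin_zero

theorem hasDerivWithinAt_der (γ : SphereCurve n) (k : ℕ) {t : ℝ} (ht : t ∈ Icc (0 : ℝ) 1) :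
    HasDerivWithinAt (γ.der k) (γ.der (k + 1) t) (Icc 0 1) t := by
  have := (isSmoothFamily_der (n := n) k).hasDerivWithinAt γ ht
  rwa [der, iteratedDerivWithin_succ]

theorem norm_extend (γ : SphereCurve n) (t : ℝ) : ‖γ.extend t‖ = 1 := by
  simp [extend, IccExtend]

end SphereCurve
end

noncomputable section

/-! ### Frenet frames and triangular matrices of derivatives -/

/-- The `j`-th column of a matrix, as a vector of the Euclidean space. -/
def Matrix.euclideanCol {m : ℕ} (M : Matrix (Fin m) (Fin m) ℝ) (j : Fin m) :
    EuclideanSpace ℝ (Fin m) :=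
  WithLp.toLp 2 fun i => M i j

theorem Matrix.inner_euclideanCol {m : ℕ} (M N : Matrix (Fin m) (Fin m) ℝ) (i j : Fin m) :
    inner ℝ (M.euclideanCol i) (N.euclideanCol j) = (M.transpose * N) i j := by
  simp [Matrix.euclideanCol, PiLp.inner_apply, Matrix.mul_apply, mul_comm]

theorem Matrix.orthonormal_euclideanCol {m : ℕ} {M : Matrix (Fin m) (Fin m) ℝ}
    (hM : M ∈ Matrix.orthogonalGroup (Fin m) ℝ) : Orthonormal ℝ M.euclideanCol := by
  rw [Matrix.mem_orthogonalGroup_iff'] at hM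
  rw [orthonormal_iff_ite]
  intro i j
  rw [Matrix.inner_euclideanCol, hM, Matrix.one_apply]

open InnerProductSpace in
/-- Characterization of Gram-Schmidt orthonormalization: an orthonormal basis `f` of a space of
dimension `n + 1` starts with the orthonormalization of the `n` vectors `v` if and only if the matrix
of coordinates of `v` in the basis `f` is upper triangular with positive diagonal. -/
theorem gramSchmidtNormed_eq_iff {E : Type*} [NormedAddCommGroup E] [InnerProductSpace ℝ E] {n : ℕ}
    (v : Fin n → E) (f : OrthonormalBasis (Fin (n + 1)) ℝ E) :
    (LinearIndependent ℝ v ∧ ∀ j : Fin n, f j.castSucc = gramSchmidtNormed ℝ v j) ↔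
      ∀ j : Fin n, 0 < inner ℝ (f j.castSucc) (v j) ∧
        ∀ i, j.castSucc < i → inner ℝ (f i) (v j) = 0 := by
  have hf := orthonormal_iff_ite.1 f.orthonormal
  constructor
  · rintro ⟨hv, h⟩ j
    have hg : ∀ k, gramSchmidt ℝ v k = ‖gramSchmidt ℝ v k‖ • f k.castSucc := fun k => by
      rw [h, gramSchmidtNormed]
      simp [smul_smul, norm_ne_zero_iff.2 (gramSchmidt_ne_zero k hv)]
    have hin : ∀ i, j.castSucc ≤ i →
        inner ℝ (f i) (v j) = inner ℝ (f i) (gramSchmidt ℝ v j) := fun i hi => by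
      conv_lhs => rw [gramSchmidt_def'' ℝ v j]
      rw [inner_add_right, inner_sum, add_eq_left]
      refine Finset.sum_eq_zero fun k hk => ?_
      rw [hg k, inner_smul_right, inner_smul_right, hf, if_neg, mul_zero, mul_zero]
      rintro rfl
      exact absurd (Finset.mem_Iio.1 hk) (not_lt.2 (Fin.castSucc_le_castSucc_iff.1 hi))
    refine ⟨?_, fun i hi => ?_⟩
    · rw [hin _ le_rfl, hg j, inner_smul_right, hf, if_pos rfl, mul_one]
      exact norm_pos_iff.2 (gramSchmidt_ne_zero j hv)
    · rw [hin _ hi.le, hg j, inner_smul_right, hf, if_neg hi.ne', mul_zero]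
  · intro h
    have hexp : ∀ j : Fin n, v j = inner ℝ (f j.castSucc) (v j) • f j.castSucc +
        ∑ i ∈ Finset.Iio j, inner ℝ (f i.castSucc) (v j) • f i.castSucc := fun j => by
      conv_lhs => rw [← f.sum_repr' (v j)]
      rw [Fin.sum_univ_castSucc, (h j).2 _ (Fin.castSucc_lt_last j), zero_smul, add_zero,
        ← Finset.sum_insert (f := fun i : Fin n => inner ℝ (f i.castSucc) (v j) • f i.castSucc)
          (by simp : j ∉ Finset.Iio j), Finset.Iio_insert]
      refine (Finset.sum_subset (Finset.subset_univ _) fun i _ hi => ?_).symm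
      rw [(h j).2 _ (Fin.castSucc_lt_castSucc_iff.2 (not_le.1 fun h' => hi (Finset.mem_Iic.2 h'))),
        zero_smul]
    have hg : ∀ j, gramSchmidt ℝ v j = inner ℝ (f j.castSucc) (v j) • f j.castSucc := fun j => by
      induction j using WellFoundedLT.induction with
      | ind j ih =>
        have h₁ := gramSchmidt_def'' ℝ v j
        have h₂ : ∑ i ∈ Finset.Iio j, (inner ℝ (gramSchmidt ℝ v i) (v j) /
            ((‖gramSchmidt ℝ v i‖ : ℝ) : ℝ) ^ 2) • gramSchmidt ℝ v i =
            ∑ i ∈ Finset.Iio j, inner ℝ (f i.castSucc) (v j) • f i.castSucc := by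
          refine Finset.sum_congr rfl fun i hi => ?_
          have hi' := (h i).1
          rw [ih i (Finset.mem_Iio.1 hi), norm_smul, f.orthonormal.1, mul_one, real_inner_smul_left,
            smul_smul, Real.norm_of_nonneg hi'.le]
          congr 1
          field_simp
        simp only [RCLike.ofReal_real_eq_id, id] at h₁
        rw [h₂] at h₁
        exact add_right_cancel (h₁.symm.trans (hexp j))
    have hne : ∀ j, gramSchmidt ℝ v j ≠ 0 := fun j => by
      rw [hg j]
      exact smul_ne_zero (h j).1.ne' (f.orthonormal.ne_zero _)
    refine ⟨?_, fun j => ?_⟩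
    · have hli : LinearIndependent ℝ (gramSchmidt ℝ v) :=
        linearIndependent_of_ne_zero_of_inner_eq_zero hne
          fun i j hij => gramSchmidt_orthogonal ℝ v hij
      rw [linearIndependent_iff_card_eq_finrank_span] at hli ⊢
      rw [hli, Set.finrank, Set.finrank, span_gramSchmidt]
    · rw [gramSchmidtNormed, hg j, norm_smul, f.orthonormal.1, mul_one,
        Real.norm_of_nonneg (h j).1.le, smul_smul]
      simp [(h j).1.ne']

/-- The orthonormal basis formed by the columns of an orthogonal matrix. -/
def Matrix.euclideanColBasis {m : ℕ} {M : Matrix (Fin m) (Fin m) ℝ}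
    (hM : M ∈ Matrix.orthogonalGroup (Fin m) ℝ) :
    OrthonormalBasis (Fin m) ℝ (EuclideanSpace ℝ (Fin m)) :=
  OrthonormalBasis.mk (Matrix.orthonormal_euclideanCol hM)
    ((Matrix.orthonormal_euclideanCol hM).linearIndependent.span_eq_top_of_card_eq_finrank'
      (by simp)).ge

theorem Matrix.euclideanColBasis_apply {m : ℕ} {M : Matrix (Fin m) (Fin m) ℝ}
    (hM : M ∈ Matrix.orthogonalGroup (Fin m) ℝ) (j : Fin m) :
    Matrix.euclideanColBasis hM j = M.euclideanCol j := by
  simp [Matrix.euclideanColBasis]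

namespace SphereCurve

open Set

variable {n : ℕ} {γ : SphereCurve n} {F : unitInterval → Matrix (Fin (n + 1)) (Fin (n + 1)) ℝ}

/-- A curve of rotations is the Frenet frame curve of the generic curve `γ` if and only if the
coordinates of `γ, γ', …, γ⁽ⁿ⁻¹⁾` in its columns form an upper triangular matrix with positive
diagonal. -/
theorem isGeneric_and_isFrenetFrame_iff :
    γ.IsGeneric ∧ γ.IsFrenetFrame F ↔
      (∀ t, F t ∈ Matrix.specialOrthogonalGroup (Fin (n + 1)) ℝ) ∧
      ∀ (t : unitInterval) (j : Fin n),
        0 < inner ℝ ((F t).euclideanCol j.castSucc) (γ.der j t) ∧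
        ∀ i, j.castSucc < i → inner ℝ ((F t).euclideanCol i) (γ.der j t) = 0 := by
  have key : ∀ (t : unitInterval), F t ∈ Matrix.specialOrthogonalGroup (Fin (n + 1)) ℝ →
      ((LinearIndependent ℝ (fun k : Fin n => γ.der k t) ∧
        ∀ (i : Fin (n + 1)) (j : Fin n), F t i j.castSucc =
          InnerProductSpace.gramSchmidtNormed ℝ (fun k : Fin n => γ.der k t) j i) ↔
      ∀ j : Fin n, 0 < inner ℝ ((F t).euclideanCol j.castSucc) (γ.der j t) ∧
        ∀ i, j.castSucc < i → inner ℝ ((F t).euclideanCol i) (γ.der j t) = 0) := by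
    intro t ht
    have ho := (Matrix.mem_specialOrthogonalGroup_iff.1 ht).1
    have h := gramSchmidtNormed_eq_iff (fun k : Fin n => γ.der k t) (Matrix.euclideanColBasis ho)
    simp only [Matrix.euclideanColBasis_apply] at h
    rw [← h, forall_comm]
    refine and_congr_right fun _ => forall_congr' fun j => ?_
    rw [PiLp.ext_iff]
    rfl
  constructor
  · rintro ⟨hg, hF⟩
    exact ⟨fun t => (hF t).1, fun t => (key t (hF t).1).1 ⟨hg t, (hF t).2⟩⟩
  · rintro ⟨hS, h⟩
    exact ⟨fun t => ((key t (hS t)).2 (h t)).1, fun t => ⟨hS t, ((key t (hS t)).2 (h t)).2⟩⟩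

theorem IsLocallyConvex.isGeneric (h : γ.IsLocallyConvex) : γ.IsGeneric := by
  intro t
  have h₁ := Matrix.linearIndependent_cols_of_det_ne_zero (h t).ne'
  have h₂ : LinearIndependent ℝ fun k : Fin (n + 1) => γ.der k t :=
    LinearIndependent.of_comp (WithLp.linearEquiv 2 ℝ (Fin (n + 1) → ℝ)).toLinearMap h₁
  exact h₂.comp Fin.castSucc (Fin.castSucc_injective n)

/-- For a curve with Frenet frame `F`, the sign of `det (γ, γ', …, γ⁽ⁿ⁾)` is that of the component of
`γ⁽ⁿ⁾` along the last vector of the frame. -/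
theorem isLocallyConvex_iff (hg : γ.IsGeneric) (hF : γ.IsFrenetFrame F) :
    γ.IsLocallyConvex ↔
      ∀ t, 0 < inner ℝ ((F t).euclideanCol (Fin.last n)) (γ.der n t) := by
  obtain ⟨hS, h⟩ := isGeneric_and_isFrenetFrame_iff.1 ⟨hg, hF⟩
  refine forall_congr' fun t => ?_
  set M := Matrix.of fun i k : Fin (n + 1) => γ.der k t i with hM
  have hMc : ∀ k, M.euclideanCol k = γ.der k t := fun k => by
    ext i; simp [Matrix.euclideanCol, hM]
  have hdet : M.det = ((F t).transpose * M).det := by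
    rw [Matrix.det_mul, Matrix.det_transpose, (Matrix.mem_specialOrthogonalGroup_iff.1 (hS t)).2,
      one_mul]
  have htri : ((F t).transpose * M).IsUpperTriangular := by
    intro i j hij
    change j < i at hij
    rw [← Matrix.inner_euclideanCol, hMc]
    exact (h t (j.castPred (hij.trans_le (Fin.le_last i)).ne)).2 i (by simpa using hij)
  rw [hdet, Matrix.det_of_isUpperTriangular htri, Fin.prod_univ_castSucc,
    ← Matrix.inner_euclideanCol, hMc]
  refine mul_pos_iff_of_pos_left (Finset.prod_pos fun j _ => ?_)
  rw [← Matrix.inner_euclideanCol, hMc]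
  exact (h t j).1

/-- Differentiating `⟨fᵢ, γ⁽ʲ⁾⟩ = 0` along an orthonormal frame `f` gives the component of `γ⁽ʲ⁺¹⁾`
along `fᵢ` in terms of those of `γ⁽ʲ⁾` and of the coefficients `⟨fᵢ, fₖ'⟩` of the frame equation. -/
theorem inner_der_succ {f f' : Fin (n + 1) → ℝ → EuclideanSpace ℝ (Fin (n + 1))}
    (hf : ∀ t ∈ Icc (0 : ℝ) 1, Orthonormal ℝ fun i => f i t)
    (hd : ∀ i, ∀ t ∈ Icc (0 : ℝ) 1, HasDerivWithinAt (f i) (f' i t) (Icc 0 1) t)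
    {i : Fin (n + 1)} {j : ℕ} (h₀ : ∀ t ∈ Icc (0 : ℝ) 1, inner ℝ (f i t) (γ.der j t) = 0)
    {t : ℝ} (ht : t ∈ Icc (0 : ℝ) 1) :
    inner ℝ (f i t) (γ.der (j + 1) t) =
      ∑ k, inner ℝ (f i t) (f' k t) * inner ℝ (f k t) (γ.der j t) := by
  have hu := uniqueDiffOn_Icc (zero_lt_one' ℝ) t ht
  have h₁ : inner ℝ (f i t) (γ.der (j + 1) t) + inner ℝ (f' i t) (γ.der j t) = 0 :=
    hu.eq_deriv _ ((hd i t ht).inner ℝ (γ.hasDerivWithinAt_der j ht))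
      ((hasDerivWithinAt_const t _ (0 : ℝ)).congr h₀ (h₀ t ht))
  have hskew : ∀ k, inner ℝ (f i t) (f' k t) + inner ℝ (f' i t) (f k t) = 0 := fun k =>
    hu.eq_deriv _ ((hd i t ht).inner ℝ (hd k t ht))
      ((hasDerivWithinAt_const t _ (if i = k then (1 : ℝ) else 0)).congr
        (fun s hs => orthonormal_iff_ite.1 (hf s hs) i k) (orthonormal_iff_ite.1 (hf t ht) i k))
  let b : OrthonormalBasis (Fin (n + 1)) ℝ (EuclideanSpace ℝ (Fin (n + 1))) :=
    OrthonormalBasis.mk (hf t ht)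
      ((hf t ht).linearIndependent.span_eq_top_of_card_eq_finrank' (by simp)).ge
  have hb : ∀ k, b k = f k t := fun k => by simp [b]
  have h₂ : inner ℝ (f' i t) (γ.der j t) =
      ∑ k, inner ℝ (f' i t) (f k t) * inner ℝ (f k t) (γ.der j t) := by
    simpa only [hb] using (b.sum_inner_mul_inner (f' i t) (γ.der j t)).symm
  rw [eq_neg_of_add_eq_zero_left h₁, h₂, ← Finset.sum_neg_distrib]
  refine Finset.sum_congr rfl fun k _ => ?_
  rw [eq_neg_of_add_eq_zero_left (hskew k), neg_mul]

end SphereCurve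
end

noncomputable section

/-! ### Unit quaternions and the spin projections -/

namespace Quaternion

instance : StarModule ℝ ℍ[ℝ] := ⟨fun r q => by ext <;> simp⟩

theorem re_quaternionBasis (k : Fin 4) : (quaternionBasis k).re = ![1, 0, 0, 0] k := by
  fin_cases k <;> rfl

theorem imI_quaternionBasis (k : Fin 4) : (quaternionBasis k).imI = ![0, 1, 0, 0] k := by
  fin_cases k <;> rfl

theorem imJ_quaternionBasis (k : Fin 4) : (quaternionBasis k).imJ = ![0, 0, 1, 0] k := by
  fin_cases k <;> rfl

theorem imK_quaternionBasis (k : Fin 4) : (quaternionBasis k).imK = ![0, 0, 0, 1] k := by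
  fin_cases k <;> rfl

theorem quaternionBasis_zero : quaternionBasis 0 = 1 := rfl

theorem quaternionBasis_one_mul_two :
    quaternionBasis 1 * quaternionBasis 2 = quaternionBasis 3 := by
  ext <;> simp [re_quaternionBasis, imI_quaternionBasis, imJ_quaternionBasis, imK_quaternionBasis]

theorem real_inner_eq (p q : ℍ[ℝ]) :
    inner ℝ p q = p.re * q.re + p.imI * q.imI + p.imJ * q.imJ + p.imK * q.imK := by
  simp [inner_def]

theorem inner_quaternionBasis (k l : Fin 4) :
    inner ℝ (quaternionBasis k) (quaternionBasis l) = if k = l then 1 else 0 := by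
  rw [real_inner_eq]
  fin_cases k <;> fin_cases l <;>
    simp [re_quaternionBasis, imI_quaternionBasis, imJ_quaternionBasis, imK_quaternionBasis]

theorem norm_quaternionBasis (k : Fin 4) : ‖quaternionBasis k‖ = 1 := by
  rw [norm_eq_sqrt_real_inner, inner_quaternionBasis, if_pos rfl, Real.sqrt_one]

theorem sum_sq_eq_one {z : ℍ[ℝ]} (hz : ‖z‖ = 1) :
    z.re ^ 2 + z.imI ^ 2 + z.imJ ^ 2 + z.imK ^ 2 = 1 := by
  rw [← normSq_def', normSq_eq_norm_mul_self, hz, one_mul]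

theorem star_mul_self_of_norm {z : ℍ[ℝ]} (hz : ‖z‖ = 1) : star z * z = 1 := by
  rw [star_mul_self, normSq_eq_norm_mul_self, hz, one_mul, coe_one]

theorem self_mul_star_of_norm {z : ℍ[ℝ]} (hz : ‖z‖ = 1) : z * star z = 1 := by
  rw [self_mul_star, normSq_eq_norm_mul_self, hz, one_mul, coe_one]

theorem re_mul_mul_star {z : ℍ[ℝ]} (hz : ‖z‖ = 1) (p : ℍ[ℝ]) : (z * p * star z).re = p.re := by
  have h : (z * p * star z).re = (z.re ^ 2 + z.imI ^ 2 + z.imJ ^ 2 + z.imK ^ 2) * p.re := by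
    simp only [re_mul, imI_mul, imJ_mul, imK_mul, re_star, imI_star, imJ_star, imK_star]
    ring
  rw [h, sum_sq_eq_one hz, one_mul]

/-- Cancellation of the inner unit quaternion in a product of two sandwiches. -/
theorem mul_mul_star_mul {w : ℍ[ℝ]} (hw : ‖w‖ = 1) (z p q v : ℍ[ℝ]) :
    (z * p * star w) * (w * q * star v) = z * (p * q) * star v := by
  calc (z * p * star w) * (w * q * star v) = z * p * (star w * w) * (q * star v) := by noncomm_ring
    _ = _ := by rw [star_mul_self_of_norm hw]; noncomm_ring

theorem star_mul_mul_star (z p w : ℍ[ℝ]) : star (z * p * star w) = w * star p * star z := by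
  rw [star_mul, star_mul, star_star, mul_assoc]

/-- The map `q ↦ z q w̄` is orthogonal for unit quaternions `z` and `w`. -/
theorem inner_mul_mul_star {z w : ℍ[ℝ]} (hz : ‖z‖ = 1) (hw : ‖w‖ = 1) (p q : ℍ[ℝ]) :
    inner ℝ (z * p * star w) (z * q * star w) = inner ℝ p q := by
  rw [inner_def, star_mul_mul_star, mul_mul_star_mul hw, re_mul_mul_star hz, inner_def]

theorem norm_mul_mul_star {z w : ℍ[ℝ]} (hz : ‖z‖ = 1) (hw : ‖w‖ = 1) (p : ℍ[ℝ]) :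
    ‖z * p * star w‖ = ‖p‖ := by
  rw [norm_mul, norm_mul, norm_star, hz, hw, one_mul, mul_one]

/-- The rotation `e ↦ z e z̄` recovers the unit quaternion `z` up to sign: this identity expresses
`4 Re(u) u`, where `u = z w̄`, in terms of the rotations defined by `z` and by `w`. -/
theorem sum_mul_star (z w : ℍ[ℝ]) :
    ∑ k, (z * quaternionBasis k * star z) * star (w * quaternionBasis k * star w) =
      (4 * (z * star w).re) • (z * star w) := by
  have h : ∀ p : ℍ[ℝ], ∑ k, quaternionBasis k * p * star (quaternionBasis k) =
      ((4 * p.re : ℝ) : ℍ[ℝ]) := fun p => by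
    rw [Fin.sum_univ_four]
    ext <;> simp [re_quaternionBasis, imI_quaternionBasis, imJ_quaternionBasis,
      imK_quaternionBasis]
    ring
  have h₂ : (star z * w).re = (z * star w).re := by
    simp only [re_mul, re_star, imI_star, imJ_star, imK_star]
    ring
  calc ∑ k, (z * quaternionBasis k * star z) * star (w * quaternionBasis k * star w)
      = ∑ k, z * (quaternionBasis k * (star z * w) * star (quaternionBasis k)) * star w :=
        Finset.sum_congr rfl fun k _ => by rw [star_mul_mul_star]; noncomm_ring
    _ = (4 * (z * star w).re) • (z * star w) := by
        rw [← Finset.sum_mul, ← Finset.mul_sum, h, h₂, mul_coe_eq_smul, smul_mul_assoc]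

/-- The projection of the quaternions to the imaginary quaternions `ℝ³`. -/
def imL : ℍ[ℝ] →L[ℝ] EuclideanSpace ℝ (Fin 3) :=
  LinearMap.toContinuousLinearMap
    { toFun := fun q => !₂[q.imI, q.imJ, q.imK]
      map_add' := fun p q => by ext i; fin_cases i <;> simp
      map_smul' := fun r q => by ext i; fin_cases i <;> simp }

theorem imL_apply (q : ℍ[ℝ]) : imL q = !₂[q.imI, q.imJ, q.imK] := rfl

/-- The embedding of `ℝ³` in the quaternions as the space of imaginary quaternions. -/
def ofImL : EuclideanSpace ℝ (Fin 3) →L[ℝ] ℍ[ℝ] :=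
  LinearMap.toContinuousLinearMap
    { toFun := fun x => ⟨0, x 0, x 1, x 2⟩
      map_add' := fun _ _ => Quaternion.ext _ _ (add_zero (0 : ℝ)).symm rfl rfl rfl
      map_smul' := fun r _ => Quaternion.ext _ _ (mul_zero r).symm rfl rfl rfl }

theorem ofImL_imL {q : ℍ[ℝ]} (hq : q.re = 0) : ofImL (imL q) = q :=
  Quaternion.ext _ _ hq.symm rfl rfl rfl

theorem imL_ofImL (x : EuclideanSpace ℝ (Fin 3)) : imL (ofImL x) = x := by
  ext i; fin_cases i <;> rfl

theorem inner_imL {p : ℍ[ℝ]} (hp : p.re = 0) (q : ℍ[ℝ]) :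
    inner ℝ (imL p) (imL q) = inner ℝ p q := by
  simp [imL_apply, PiLp.inner_apply, Fin.sum_univ_three, real_inner_eq, hp]
  ring

theorem norm_imL {p : ℍ[ℝ]} (hp : p.re = 0) : ‖imL p‖ = ‖p‖ := by
  rw [norm_eq_sqrt_real_inner, inner_imL hp, ← norm_eq_sqrt_real_inner]

theorem toLp_crossProduct_imL (p q : ℍ[ℝ]) (hp : p.re = 0) (hq : q.re = 0) :
    WithLp.toLp 2 (crossProduct (imL p).ofLp (imL q).ofLp) = imL (p * q) := by
  ext i
  fin_cases i <;> simp [imL_apply, cross_apply, hp, hq]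
  ring

end Quaternion

open Quaternion

theorem norm_unitQuaternion (z : UnitQuaternion) : ‖(z : ℍ[ℝ])‖ = 1 := by simp

theorem euclideanCol_spinProj3 (z : UnitQuaternion) (j : Fin 3) :
    (spinProj3 z).euclideanCol j = imL ((z : ℍ[ℝ]) * quaternionBasis j.succ * star (z : ℍ[ℝ])) := by
  ext i; fin_cases i <;> rfl

theorem euclideanCol_spinProj4 (z w : UnitQuaternion) (j : Fin 4) :
    (spinProj4 (z, w)).euclideanCol j =
      linearIsometryEquivTuple ((z : ℍ[ℝ]) * quaternionBasis j * star (w : ℍ[ℝ])) := by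
  ext i; fin_cases i <;> rfl

theorem re_quaternionBasis_succ (j : Fin 3) : (quaternionBasis j.succ).re = 0 := by
  fin_cases j <;> rfl

theorem mem_orthogonalGroup_of_orthonormal {m : ℕ} {M : Matrix (Fin m) (Fin m) ℝ}
    (h : ∀ i j, inner ℝ (M.euclideanCol i) (M.euclideanCol j) = if i = j then (1 : ℝ) else 0) :
    M ∈ Matrix.orthogonalGroup (Fin m) ℝ := by
  rw [Matrix.mem_orthogonalGroup_iff']
  ext i j
  rw [Matrix.one_apply, ← h, Matrix.inner_euclideanCol]

theorem spinProj3_mem (z : UnitQuaternion) :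
    spinProj3 z ∈ Matrix.specialOrthogonalGroup (Fin 3) ℝ := by
  have hz := norm_unitQuaternion z
  refine Matrix.mem_specialOrthogonalGroup_iff.2
    ⟨mem_orthogonalGroup_of_orthonormal fun i j => ?_, ?_⟩
  · rw [euclideanCol_spinProj3, euclideanCol_spinProj3, inner_imL, inner_mul_mul_star hz hz,
      inner_quaternionBasis]
    · simp
    · rw [re_mul_mul_star hz, re_quaternionBasis_succ]
  · have h : (spinProj3 z).det =
        ((z : ℍ[ℝ]).re ^ 2 + (z : ℍ[ℝ]).imI ^ 2 + (z : ℍ[ℝ]).imJ ^ 2 + (z : ℍ[ℝ]).imK ^ 2) ^ 3 := by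
      simp [spinProj3, Matrix.det_fin_three, quaternionCoord, re_quaternionBasis,
        imI_quaternionBasis, imJ_quaternionBasis, imK_quaternionBasis]
      ring
    rw [h, sum_sq_eq_one hz, one_pow]

theorem det_mul_quaternionBasis (z : ℍ[ℝ]) :
    (Matrix.of fun i j => quaternionCoord (z * quaternionBasis j) i).det =
      (z.re ^ 2 + z.imI ^ 2 + z.imJ ^ 2 + z.imK ^ 2) ^ 2 := by
  have h : (Matrix.of fun i j => quaternionCoord (z * quaternionBasis j) i) =
      !![z.re, -z.imI, -z.imJ, -z.imK; z.imI, z.re, -z.imK, z.imJ;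
        z.imJ, z.imK, z.re, -z.imI; z.imK, -z.imJ, z.imI, z.re] := by
    ext i j
    fin_cases i <;> fin_cases j <;> simp [quaternionCoord, re_quaternionBasis,
        imI_quaternionBasis, imJ_quaternionBasis, imK_quaternionBasis]
  rw [h]
  simp [Matrix.det_succ_row_zero, Fin.sum_univ_succ, Fin.succAbove]
  ring

theorem det_quaternionBasis_mul_star (z : ℍ[ℝ]) :
    (Matrix.of fun i j => quaternionCoord (quaternionBasis j * star z) i).det =
      (z.re ^ 2 + z.imI ^ 2 + z.imJ ^ 2 + z.imK ^ 2) ^ 2 := by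
  have h : (Matrix.of fun i j => quaternionCoord (quaternionBasis j * star z) i) =
      !![z.re, z.imI, z.imJ, z.imK; -z.imI, z.re, -z.imK, z.imJ;
        -z.imJ, z.imK, z.re, -z.imI; -z.imK, -z.imJ, z.imI, z.re] := by
    ext i j
    fin_cases i <;> fin_cases j <;> simp [quaternionCoord, re_quaternionBasis,
        imI_quaternionBasis, imJ_quaternionBasis, imK_quaternionBasis]
  rw [h]
  simp [Matrix.det_succ_row_zero, Fin.sum_univ_succ, Fin.succAbove]
  ring

theorem spinProj4_eq_mul (z w : UnitQuaternion) :
    spinProj4 (z, w) =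
      (Matrix.of fun i j => quaternionCoord ((z : ℍ[ℝ]) * quaternionBasis j) i) *
      (Matrix.of fun i j => quaternionCoord (quaternionBasis j * star (w : ℍ[ℝ])) i) := by
  ext i j
  rw [Matrix.mul_apply, Fin.sum_univ_four]
  fin_cases i <;> simp [spinProj4, quaternionCoord, re_quaternionBasis,
        imI_quaternionBasis, imJ_quaternionBasis, imK_quaternionBasis] <;> ring

theorem spinProj4_mem (z w : UnitQuaternion) :
    spinProj4 (z, w) ∈ Matrix.specialOrthogonalGroup (Fin 4) ℝ := by
  have hz := norm_unitQuaternion z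
  have hw := norm_unitQuaternion w
  refine Matrix.mem_specialOrthogonalGroup_iff.2
    ⟨mem_orthogonalGroup_of_orthonormal fun i j => ?_, ?_⟩
  · rw [euclideanCol_spinProj4, euclideanCol_spinProj4, LinearIsometryEquiv.inner_map_map,
      inner_mul_mul_star hz hw, inner_quaternionBasis]
  · rw [spinProj4_eq_mul, Matrix.det_mul, det_mul_quaternionBasis, det_quaternionBasis_mul_star,
      sum_sq_eq_one hz, sum_sq_eq_one hw, one_pow, one_mul]

/-- Uniqueness of lifts through `Π₃`, in terms of the images of `𝐢` and `𝐣`, which determine a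
rotation. -/
theorem eq_of_mul_quaternionBasis_eq {Γ Δ : unitInterval → UnitQuaternion} (hΓ : Continuous Γ)
    (hΔ : Continuous Δ) (h₀ : Γ 0 = Δ 0)
    (h : ∀ t, ∀ k ∈ ({1, 2} : Set (Fin 4)),
      (Γ t : ℍ[ℝ]) * quaternionBasis k * star (Γ t : ℍ[ℝ]) =
        (Δ t : ℍ[ℝ]) * quaternionBasis k * star (Δ t : ℍ[ℝ])) : Γ = Δ := by
  have hall : ∀ t k, (Γ t : ℍ[ℝ]) * quaternionBasis k * star (Γ t : ℍ[ℝ]) =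
      (Δ t : ℍ[ℝ]) * quaternionBasis k * star (Δ t : ℍ[ℝ]) := by
    intro t k
    fin_cases k
    · simp [quaternionBasis_zero, self_mul_star_of_norm]
    · exact h t 1 (by simp)
    · exact h t 2 (by simp)
    · change _ * quaternionBasis 3 * _ = _ * quaternionBasis 3 * _
      rw [← quaternionBasis_one_mul_two, ← mul_mul_star_mul (norm_unitQuaternion _),
        ← mul_mul_star_mul (norm_unitQuaternion _), h t 1 (by simp), h t 2 (by simp)]
  set r : unitInterval → ℝ := fun t => ((Γ t : ℍ[ℝ]) * star (Δ t : ℍ[ℝ])).re with hr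
  have hrc : Continuous r :=
    continuous_re.comp ((continuous_subtype_val.comp hΓ).mul (continuous_subtype_val.comp hΔ).star)
  have h₁ : ∀ t, r t • ((Γ t : ℍ[ℝ]) * star (Δ t : ℍ[ℝ])) = 1 := fun t => by
    have h₂ := sum_mul_star (Γ t : ℍ[ℝ]) (Δ t)
    simp only [hall] at h₂
    rw [Finset.sum_congr rfl (g := fun _ => (1 : ℍ[ℝ])) fun k _ => self_mul_star_of_norm (by
      rw [norm_mul_mul_star (norm_unitQuaternion _) (norm_unitQuaternion _),
        norm_quaternionBasis])] at h₂
    rw [mul_smul] at h₂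
    have h₃ : (4 : ℝ) • (1 : ℍ[ℝ]) = (4 : ℝ) • (r t • ((Γ t : ℍ[ℝ]) * star (Δ t : ℍ[ℝ]))) := by
      rw [hr, ← h₂, Finset.sum_const, Finset.card_univ, Fintype.card_fin, ← Nat.cast_smul_eq_nsmul ℝ]
      norm_num
    exact ((smul_right_injective _ (four_ne_zero' ℝ)) h₃).symm
  have h₂ : ∀ t, r t = 1 ∨ r t = -1 := fun t => by
    have h₃ := congrArg (fun q : ℍ[ℝ] => q.re) (h₁ t)
    simp only [re_smul, re_one, smul_eq_mul] at h₃
    exact mul_self_eq_one_iff.1 h₃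
  have h₃ : ∀ t, r t = 1 := fun t => by
    rcases h₂ t with h | h
    · exact h
    · -- otherwise `r` would vanish somewhere, by the intermediate value theorem
      have hr0 : r 0 = 1 := by
        simp only [hr, h₀, self_mul_star_of_norm (norm_unitQuaternion _), re_one]
      obtain ⟨s, hs⟩ := mem_range_of_exists_le_of_exists_ge hrc ⟨t, h.le.trans (by norm_num)⟩
        ⟨0, (zero_le_one' ℝ).trans hr0.ge⟩
      rcases h₂ s with h' | h' <;> norm_num [hs] at h'
  funext t
  ext1
  have h₄ := h₁ t
  rw [h₃, one_smul] at h₄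
  calc (Γ t : ℍ[ℝ]) = Γ t * (star (Δ t : ℍ[ℝ]) * Δ t) := by
        rw [star_mul_self_of_norm (norm_unitQuaternion _), mul_one]
    _ = Δ t := by rw [← mul_assoc, h₄, one_mul]
end

noncomputable section

/-! ### Differentiable curves of unit quaternions -/

section SpinCurves

open Set Quaternion

/-- `z` is a curve of unit quaternions on `[0,1]` with logarithmic derivative `α = z⁻¹ z'`, an
imaginary quaternion. -/
structure IsSpinCurve (z α : ℝ → ℍ[ℝ]) : Prop where
  norm_eq : ∀ t ∈ Icc (0 : ℝ) 1, ‖z t‖ = 1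
  hasDerivWithinAt : ∀ t ∈ Icc (0 : ℝ) 1, HasDerivWithinAt z (z t * α t) (Icc 0 1) t
  re_eq : ∀ t ∈ Icc (0 : ℝ) 1, (α t).re = 0

/-- A continuous curve `z` of unit quaternions is differentiable if the images of `𝐢` and `𝐣` under
the rotation `h ↦ z h z̄` are. -/
theorem differentiableOn_of_mul_mul_star {z : ℝ → ℍ[ℝ]} (hz : ContinuousOn z (Icc 0 1))
    (hn : ∀ t ∈ Icc (0 : ℝ) 1, ‖z t‖ = 1)
    (h₁ : DifferentiableOn ℝ (fun t => z t * quaternionBasis 1 * star (z t)) (Icc 0 1))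
    (h₂ : DifferentiableOn ℝ (fun t => z t * quaternionBasis 2 * star (z t)) (Icc 0 1)) :
    DifferentiableOn ℝ z (Icc 0 1) := by
  have hall : ∀ k, DifferentiableOn ℝ (fun t => z t * quaternionBasis k * star (z t))
      (Icc 0 1) := by
    intro k
    fin_cases k
    · refine (differentiableOn_const 1).congr fun t ht => ?_
      simp [quaternionBasis_zero, self_mul_star_of_norm (hn t ht)]
    · exact h₁
    · exact h₂
    · refine (h₁.mul h₂).congr fun t ht => ?_
      change _ * quaternionBasis 3 * _ = _
      rw [Pi.mul_apply, mul_mul_star_mul (hn t ht), quaternionBasis_one_mul_two]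
  intro t₀ ht₀
  set w := z t₀ with hw
  have hwn : ‖w‖ = 1 := hn t₀ ht₀
  set u : ℝ → ℍ[ℝ] := fun t => z t * star w with hu
  set S : ℝ → ℍ[ℝ] := fun t => ∑ k, (z t * quaternionBasis k * star (z t)) *
    star (w * quaternionBasis k * star w) with hS
  have hSd : DifferentiableWithinAt ℝ S (Icc 0 1) t₀ := by
    have : DifferentiableOn ℝ S (Icc 0 1) :=
      DifferentiableOn.fun_sum fun k _ => (hall k).mul_const _
    exact this t₀ ht₀
  have hSu : ∀ t, S t = (4 * (u t).re) • u t := fun t => sum_mul_star _ _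
  have hSre : ∀ t, (S t).re = 4 * (u t).re ^ 2 := fun t => by
    rw [hSu, re_smul, smul_eq_mul]; ring
  have hut₀ : u t₀ = 1 := by rw [hu]; exact self_mul_star_of_norm hwn
  have hpos : ∀ᶠ t in nhdsWithin t₀ (Icc 0 1), 0 < (u t).re := by
    have hc : ContinuousWithinAt (fun t => (u t).re) (Icc 0 1) t₀ :=
      continuous_re.continuousAt.comp_continuousWithinAt
        ((hz t₀ ht₀).mul continuousWithinAt_const)
    exact hc.eventually (lt_mem_nhds (by simp [hut₀]))
  have hre : DifferentiableWithinAt ℝ (fun t => (S t).re) (Icc 0 1) t₀ := by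
    have := (innerSL ℝ (1 : ℍ[ℝ])).differentiableAt.comp_differentiableWithinAt t₀ hSd
    refine this.congr (fun t _ => ?_) ?_ <;> simp [real_inner_eq]
  have hsq : DifferentiableWithinAt ℝ (fun t => (2 * √((S t).re))⁻¹ • S t) (Icc 0 1) t₀ := by
    have h₀ : (S t₀).re ≠ 0 := by rw [hSre, hut₀]; simp
    refine DifferentiableWithinAt.fun_smul (DifferentiableWithinAt.fun_inv
      ((hre.sqrt h₀).const_mul 2) ?_) hSd
    rw [hSre, hut₀]
    simp
  have hud : DifferentiableWithinAt ℝ u (Icc 0 1) t₀ := by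
    have hev : ∀ t, 0 < (u t).re → u t = (2 * √((S t).re))⁻¹ • S t := fun t ht => by
      have : √((S t).re) = 2 * (u t).re := by
        rw [hSre, show 4 * (u t).re ^ 2 = (2 * (u t).re) ^ 2 by ring,
          Real.sqrt_sq (by positivity)]
      rw [this, hSu, smul_smul]
      have h' : (2 * (2 * (u t).re))⁻¹ * (4 * (u t).re) = 1 := by field_simp; norm_num
      rw [h', one_smul]
    exact hsq.congr_of_eventuallyEq (hpos.mono hev) (hev t₀ (by simp [hut₀]))
  refine (hud.mul_const w).congr (fun t _ => ?_) ?_ <;>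
    simp only [hu, mul_assoc, star_mul_self_of_norm hwn, mul_one]

theorem exists_isSpinCurve {z : ℝ → ℍ[ℝ]} (hz : ContinuousOn z (Icc 0 1))
    (hn : ∀ t ∈ Icc (0 : ℝ) 1, ‖z t‖ = 1)
    (h₁ : DifferentiableOn ℝ (fun t => z t * quaternionBasis 1 * star (z t)) (Icc 0 1))
    (h₂ : DifferentiableOn ℝ (fun t => z t * quaternionBasis 2 * star (z t)) (Icc 0 1)) :
    ∃ α, IsSpinCurve z α := by
  have hd := differentiableOn_of_mul_mul_star hz hn h₁ h₂
  refine ⟨fun t => star (z t) * derivWithin z (Icc 0 1) t, hn, fun t ht => ?_, fun t ht => ?_⟩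
  · rw [← mul_assoc, self_mul_star_of_norm (hn t ht), one_mul]
    exact (hd t ht).hasDerivWithinAt
  · have h := (hd t ht).hasDerivWithinAt
    have h₃ := (uniqueDiffOn_Icc (zero_lt_one' ℝ) t ht).eq_deriv _ (h.inner ℝ h)
      ((hasDerivWithinAt_const t _ (1 : ℝ)).congr
        (fun s hs => by rw [real_inner_self_eq_norm_sq, hn s hs, one_pow])
        (by rw [real_inner_self_eq_norm_sq, hn t ht, one_pow]))
    simp only [real_inner_eq] at h₃
    simp only [re_mul, re_star, imI_star, imJ_star, imK_star]
    linarith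

/-- The derivative of `z e w̄` for curves of unit quaternions `z` and `w`. -/
theorem IsSpinCurve.hasDerivWithinAt_mul_mul_star {z α w β : ℝ → ℍ[ℝ]} (hz : IsSpinCurve z α)
    (hw : IsSpinCurve w β) (e : ℍ[ℝ]) {t : ℝ} (ht : t ∈ Icc (0 : ℝ) 1) :
    HasDerivWithinAt (fun t => z t * e * star (w t)) (z t * (α t * e - e * β t) * star (w t))
      (Icc 0 1) t := by
  have hβ : star (β t) = -β t := by
    ext <;> simp [hw.re_eq t ht]
  refine (((hz.hasDerivWithinAt t ht).mul_const e).mul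
    (hw.hasDerivWithinAt t ht).star).congr_deriv ?_
  rw [star_mul, hβ]
  noncomm_ring

namespace SphereCurve

/-- The Frenet conditions for the curve `z 𝐢 z̄` and the frame `z 𝐢 z̄, z 𝐣 z̄, z 𝐤 z̄` in terms of the
logarithmic derivative of `z`. -/
theorem frenet_iff_of_isSpinCurve {γ : SphereCurve 2} {z α : ℝ → ℍ[ℝ]} (h : IsSpinCurve z α)
    (hγ : ∀ t ∈ Icc (0 : ℝ) 1, γ.extend t = imL (z t * quaternionBasis 1 * star (z t))) :
    ((∀ t ∈ Icc (0 : ℝ) 1, ∀ j : Fin 2,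
        0 < inner ℝ (imL (z t * quaternionBasis j.castSucc.succ * star (z t))) (γ.der j t) ∧
        ∀ i, j.castSucc < i →
          inner ℝ (imL (z t * quaternionBasis i.succ * star (z t))) (γ.der j t) = 0) ↔
      ∀ t ∈ Icc (0 : ℝ) 1, (α t).imJ = 0 ∧ 0 < (α t).imK) ∧
    ((∀ t ∈ Icc (0 : ℝ) 1, (α t).imJ = 0 ∧ 0 < (α t).imK) → ∀ t ∈ Icc (0 : ℝ) 1,
      inner ℝ (imL (z t * quaternionBasis 3 * star (z t))) (γ.der 2 t) =
        4 * (α t).imI * (α t).imK) := by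
  set f : Fin 3 → ℝ → EuclideanSpace ℝ (Fin 3) := fun i t =>
    imL (z t * quaternionBasis i.succ * star (z t)) with hf
  set f' : Fin 3 → ℝ → EuclideanSpace ℝ (Fin 3) := fun i t =>
    imL (z t * (α t * quaternionBasis i.succ - quaternionBasis i.succ * α t) * star (z t)) with hf'
  have hin : ∀ t ∈ Icc (0 : ℝ) 1, ∀ (i : Fin 3) q,
      inner ℝ (f i t) (imL (z t * q * star (z t))) = inner ℝ (quaternionBasis i.succ) q :=
    fun t ht i q => by
      rw [hf, inner_imL (by rw [re_mul_mul_star (h.norm_eq t ht), re_quaternionBasis_succ]),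
        inner_mul_mul_star (h.norm_eq t ht) (h.norm_eq t ht)]
  have ho : ∀ t ∈ Icc (0 : ℝ) 1, Orthonormal ℝ fun i => f i t := fun t ht =>
    orthonormal_iff_ite.2 fun i j => by
      rw [hin t ht i, inner_quaternionBasis]
      simp
  have hd : ∀ i, ∀ t ∈ Icc (0 : ℝ) 1, HasDerivWithinAt (f i) (f' i t) (Icc 0 1) t :=
    fun i t ht => imL.hasFDerivAt.comp_hasDerivWithinAt t
      (h.hasDerivWithinAt_mul_mul_star h (quaternionBasis i.succ) ht)
  have hs₀ : ∀ t ∈ Icc (0 : ℝ) 1, ∀ i, inner ℝ (f i t) (γ.der 0 t) = if i = 0 then 1 else 0 :=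
    fun t ht i => by
      rw [der_zero, hγ t ht]
      exact orthonormal_iff_ite.1 (ho t ht) i 0
  have hs₁ : ∀ t ∈ Icc (0 : ℝ) 1, ∀ i, i ≠ 0 →
      inner ℝ (f i t) (γ.der 1 t) = inner ℝ (f i t) (f' 0 t) := fun t ht i hi => by
    rw [inner_der_succ ho hd (fun s hs => by rw [hs₀ s hs, if_neg hi]) ht, Fin.sum_univ_three]
    simp [hs₀ t ht]
  have hW₁₀ : ∀ t ∈ Icc (0 : ℝ) 1, inner ℝ (f 1 t) (f' 0 t) = 2 * (α t).imK := fun t ht => by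
    rw [hf', hin t ht, real_inner_eq]
    simp [re_quaternionBasis, imI_quaternionBasis, imJ_quaternionBasis, imK_quaternionBasis]
    ring
  have hW₂₀ : ∀ t ∈ Icc (0 : ℝ) 1, inner ℝ (f 2 t) (f' 0 t) = -2 * (α t).imJ := fun t ht => by
    rw [hf', hin t ht, real_inner_eq]
    simp [re_quaternionBasis, imI_quaternionBasis, imJ_quaternionBasis, imK_quaternionBasis]
    ring
  have hW₂₁ : ∀ t ∈ Icc (0 : ℝ) 1, inner ℝ (f 2 t) (f' 1 t) = 2 * (α t).imI := fun t ht => by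
    rw [hf', hin t ht, real_inner_eq]
    simp [re_quaternionBasis, imI_quaternionBasis, imJ_quaternionBasis, imK_quaternionBasis]
    ring
  refine ⟨⟨fun H t ht => ?_, fun H t ht j => ?_⟩, fun H t ht => ?_⟩
  · have h₁ := (H t ht 1).1
    have h₂ := (H t ht 1).2 2 (by decide)
    change 0 < inner ℝ (f 1 t) (γ.der 1 t) at h₁
    change inner ℝ (f 2 t) (γ.der 1 t) = 0 at h₂
    rw [hs₁ t ht 1 (by decide), hW₁₀ t ht] at h₁
    rw [hs₁ t ht 2 (by decide), hW₂₀ t ht] at h₂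
    constructor <;> linarith
  · change 0 < inner ℝ (f j.castSucc t) (γ.der j t) ∧
      ∀ i, j.castSucc < i → inner ℝ (f i t) (γ.der j t) = 0
    fin_cases j
    · change 0 < inner ℝ (f 0 t) (γ.der 0 t) ∧ ∀ i, 0 < i → inner ℝ (f i t) (γ.der 0 t) = 0
      exact ⟨by simp [hs₀ t ht], fun i hi => by simp [hs₀ t ht, hi.ne']⟩
    · change 0 < inner ℝ (f 1 t) (γ.der 1 t) ∧ ∀ i, 1 < i → inner ℝ (f i t) (γ.der 1 t) = 0
      refine ⟨?_, fun i hi => ?_⟩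
      · rw [hs₁ t ht 1 (by decide), hW₁₀ t ht]
        linarith [(H t ht).2]
      · obtain rfl : i = 2 := by omega
        rw [hs₁ t ht 2 (by decide), hW₂₀ t ht, (H t ht).1, mul_zero]
  · change inner ℝ (f 2 t) (γ.der 2 t) = _
    have h₂ : ∀ t ∈ Icc (0 : ℝ) 1, inner ℝ (f 2 t) (γ.der 1 t) = 0 := fun t ht => by
      rw [hs₁ t ht 2 (by decide), hW₂₀ t ht, (H t ht).1, mul_zero]
    rw [inner_der_succ ho hd h₂ ht, Fin.sum_univ_three, h₂ t ht, hW₂₀ t ht, hW₂₁ t ht,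
      hs₁ t ht 1 (by decide), hW₁₀ t ht, (H t ht).1]
    ring

end SphereCurve

end SpinCurves
end

noncomputable section
open Set Quaternion

/-! ### Frenet conditions in terms of logarithmic derivatives -/

namespace SphereCurve

/-- Speed, unit tangent vector and its rotation in the Frenet frame `z 𝐢 z̄, z 𝐣 z̄, z 𝐤 z̄` of a curve
in `𝕊²`, in terms of the logarithmic derivative `a 𝐢 + c 𝐤` of `z`. -/
theorem speed_tangent_of_isSpinCurve {γ : SphereCurve 2} {z α : ℝ → ℍ[ℝ]} (h : IsSpinCurve z α)
    (hγ : ∀ t ∈ Icc (0 : ℝ) 1, γ.extend t = imL (z t * quaternionBasis 1 * star (z t)))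
    (hα : ∀ t ∈ Icc (0 : ℝ) 1, (α t).imJ = 0 ∧ 0 < (α t).imK) {t : ℝ} (ht : t ∈ Icc (0 : ℝ) 1) :
    ‖γ.der 1 t‖ = 2 * (α t).imK ∧
      inner ℝ (derivWithin γ.tangent (Icc 0 1) t) (γ.normal t) = 2 * (α t).imI := by
  have hu := uniqueDiffOn_Icc (zero_lt_one' ℝ)
  have hre : ∀ s ∈ Icc (0 : ℝ) 1, ∀ i : Fin 4, i ≠ 0 →
      (z s * quaternionBasis i * star (z s)).re = 0 := fun s hs i hi => by
    rw [re_mul_mul_star (h.norm_eq s hs), ← Fin.succ_pred i hi, re_quaternionBasis_succ]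
  have hd : ∀ s ∈ Icc (0 : ℝ) 1, ∀ e : ℍ[ℝ],
      HasDerivWithinAt (fun s => imL (z s * e * star (z s)))
        (imL (z s * (α s * e - e * α s) * star (z s))) (Icc 0 1) s := fun s hs e =>
    imL.hasFDerivAt.comp_hasDerivWithinAt s (h.hasDerivWithinAt_mul_mul_star h e hs)
  have hder : ∀ s ∈ Icc (0 : ℝ) 1, γ.der 1 s =
      (2 * (α s).imK) • imL (z s * quaternionBasis 2 * star (z s)) := fun s hs => by
    have h₁ : HasDerivWithinAt γ.extend (γ.der 1 s) (Icc 0 1) s := by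
      simpa [der_zero] using γ.hasDerivWithinAt_der 0 hs
    rw [(hu s hs).eq_deriv _ h₁ ((hd s hs (quaternionBasis 1)).congr hγ (hγ s hs)), ← map_smul,
      ← smul_mul_assoc, ← mul_smul_comm]
    congr 3
    ext <;> simp [re_quaternionBasis, imI_quaternionBasis, imJ_quaternionBasis,
      imK_quaternionBasis, hα s hs]
    ring
  have hspeed : ∀ s ∈ Icc (0 : ℝ) 1, ‖γ.der 1 s‖ = 2 * (α s).imK := fun s hs => by
    rw [hder s hs, norm_smul, norm_imL (hre s hs 2 (by decide)), norm_mul_mul_star (h.norm_eq s hs)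
      (h.norm_eq s hs), norm_quaternionBasis, mul_one, Real.norm_of_nonneg]
    linarith [(hα s hs).2]
  have htan : ∀ s ∈ Icc (0 : ℝ) 1,
      γ.tangent s = imL (z s * quaternionBasis 2 * star (z s)) := fun s hs => by
    have := (hα s hs).2
    rw [tangent, hspeed s hs, hder s hs, smul_smul, inv_mul_cancel₀ (by positivity), one_smul]
  refine ⟨hspeed t ht, ?_⟩
  rw [((hd t ht (quaternionBasis 2)).congr htan (htan t ht)).derivWithin (hu t ht), normal,
    hγ t ht, htan t ht, toLp_crossProduct_imL _ _ (hre t ht 1 (by decide))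
      (hre t ht 2 (by decide)),
    mul_mul_star_mul (h.norm_eq t ht), quaternionBasis_one_mul_two, real_inner_comm,
    inner_imL (hre t ht 3 (by decide)), inner_mul_mul_star (h.norm_eq t ht) (h.norm_eq t ht), real_inner_eq]
  simp [re_quaternionBasis, imI_quaternionBasis, imJ_quaternionBasis, imK_quaternionBasis]
  ring

/-- The Frenet conditions for the curve `z w̄` and the frame `z w̄, z 𝐢 w̄, z 𝐣 w̄, z 𝐤 w̄` in terms of
the logarithmic derivatives of `z` and `w`. -/
theorem frenet_iff_of_isSpinCurve_pair {γ : SphereCurve 3} {z α w β : ℝ → ℍ[ℝ]}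
    (hz : IsSpinCurve z α) (hw : IsSpinCurve w β)
    (hγ : ∀ t ∈ Icc (0 : ℝ) 1, γ.extend t = linearIsometryEquivTuple (z t * star (w t))) :
    ((∀ t ∈ Icc (0 : ℝ) 1, ∀ j : Fin 3,
        0 < inner ℝ (linearIsometryEquivTuple (z t * quaternionBasis j.castSucc * star (w t)))
          (γ.der j t) ∧
        ∀ i, j.castSucc < i →
          inner ℝ (linearIsometryEquivTuple (z t * quaternionBasis i * star (w t)))
            (γ.der j t) = 0) ↔
      ∀ t ∈ Icc (0 : ℝ) 1, (α t).imJ = 0 ∧ (β t).imJ = 0 ∧ (α t).imK = (β t).imK ∧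
        0 < (α t).imK ∧ (β t).imI < (α t).imI) ∧
    ((∀ t ∈ Icc (0 : ℝ) 1, (α t).imJ = 0 ∧ (β t).imJ = 0 ∧ (α t).imK = (β t).imK ∧
        0 < (α t).imK ∧ (β t).imI < (α t).imI) → ∀ t ∈ Icc (0 : ℝ) 1,
      inner ℝ (linearIsometryEquivTuple (z t * quaternionBasis 3 * star (w t))) (γ.der 3 t) =
        ((α t).imI + (β t).imI) * (2 * (α t).imK * ((α t).imI - (β t).imI))) := by
  set f : Fin 4 → ℝ → EuclideanSpace ℝ (Fin 4) := fun i t =>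
    linearIsometryEquivTuple (z t * quaternionBasis i * star (w t)) with hf
  set f' : Fin 4 → ℝ → EuclideanSpace ℝ (Fin 4) := fun i t =>
    linearIsometryEquivTuple
      (z t * (α t * quaternionBasis i - quaternionBasis i * β t) * star (w t)) with hf'
  have hin : ∀ t ∈ Icc (0 : ℝ) 1, ∀ (i : Fin 4) q,
      inner ℝ (f i t) (linearIsometryEquivTuple (z t * q * star (w t))) =
        inner ℝ (quaternionBasis i) q := fun t ht i q => by
    rw [hf, LinearIsometryEquiv.inner_map_map,
      inner_mul_mul_star (hz.norm_eq t ht) (hw.norm_eq t ht)]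
  have ho : ∀ t ∈ Icc (0 : ℝ) 1, Orthonormal ℝ fun i => f i t := fun t ht =>
    orthonormal_iff_ite.2 fun i j => by rw [hin t ht i, inner_quaternionBasis]
  have hd : ∀ i, ∀ t ∈ Icc (0 : ℝ) 1, HasDerivWithinAt (f i) (f' i t) (Icc 0 1) t :=
    fun i t ht => (linearIsometryEquivTuple.toContinuousLinearEquiv :
      ℍ[ℝ] →L[ℝ] EuclideanSpace ℝ (Fin 4)).hasFDerivAt.comp_hasDerivWithinAt t
        (hz.hasDerivWithinAt_mul_mul_star hw (quaternionBasis i) ht)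
  have hs₀ : ∀ t ∈ Icc (0 : ℝ) 1, ∀ i, inner ℝ (f i t) (γ.der 0 t) = if i = 0 then 1 else 0 :=
    fun t ht i => by
      have h : f 0 t = γ.der 0 t := by
        rw [der_zero, hγ t ht, hf]
        simp only [quaternionBasis_zero, mul_one]
      rw [← h]
      exact orthonormal_iff_ite.1 (ho t ht) i 0
  have hs₁ : ∀ t ∈ Icc (0 : ℝ) 1, ∀ i, i ≠ 0 →
      inner ℝ (f i t) (γ.der 1 t) = inner ℝ (f i t) (f' 0 t) := fun t ht i hi => by
    rw [inner_der_succ ho hd (fun s hs => by rw [hs₀ s hs, if_neg hi]) ht, Fin.sum_univ_four]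
    simp [hs₀ t ht]
  have hW : ∀ t ∈ Icc (0 : ℝ) 1, ∀ i k, inner ℝ (f i t) (f' k t) = inner ℝ (quaternionBasis i)
      (α t * quaternionBasis k - quaternionBasis k * β t) := fun t ht i k => hin t ht i _
  have h₁₀ : ∀ t ∈ Icc (0 : ℝ) 1, inner ℝ (f 1 t) (f' 0 t) = (α t).imI - (β t).imI :=
    fun t ht => by
      rw [hW t ht, real_inner_eq]
      simp [re_quaternionBasis, imI_quaternionBasis, imJ_quaternionBasis, imK_quaternionBasis]
  have h₂₀ : ∀ t ∈ Icc (0 : ℝ) 1, inner ℝ (f 2 t) (f' 0 t) = (α t).imJ - (β t).imJ :=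
    fun t ht => by
      rw [hW t ht, real_inner_eq]
      simp [re_quaternionBasis, imI_quaternionBasis, imJ_quaternionBasis, imK_quaternionBasis]
  have h₃₀ : ∀ t ∈ Icc (0 : ℝ) 1, inner ℝ (f 3 t) (f' 0 t) = (α t).imK - (β t).imK :=
    fun t ht => by
      rw [hW t ht, real_inner_eq]
      simp [re_quaternionBasis, imI_quaternionBasis, imJ_quaternionBasis, imK_quaternionBasis]
  have h₂₁ : ∀ t ∈ Icc (0 : ℝ) 1, inner ℝ (f 2 t) (f' 1 t) = (α t).imK + (β t).imK :=
    fun t ht => by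
      rw [hW t ht, real_inner_eq]
      simp [re_quaternionBasis, imI_quaternionBasis, imJ_quaternionBasis, imK_quaternionBasis]
  have h₃₁ : ∀ t ∈ Icc (0 : ℝ) 1, inner ℝ (f 3 t) (f' 1 t) = -(α t).imJ - (β t).imJ :=
    fun t ht => by
      rw [hW t ht, real_inner_eq]
      simp [re_quaternionBasis, imI_quaternionBasis, imJ_quaternionBasis, imK_quaternionBasis]
  have h₃₂ : ∀ t ∈ Icc (0 : ℝ) 1, inner ℝ (f 3 t) (f' 2 t) = (α t).imI + (β t).imI :=
    fun t ht => by
      rw [hW t ht, real_inner_eq]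
      simp [re_quaternionBasis, imI_quaternionBasis, imJ_quaternionBasis, imK_quaternionBasis]
  have hs₂ : (∀ t ∈ Icc (0 : ℝ) 1, (α t).imJ = (β t).imJ ∧ (α t).imK = (β t).imK) →
      ∀ t ∈ Icc (0 : ℝ) 1, ∀ i, 1 < i → inner ℝ (f i t) (γ.der 2 t) =
        inner ℝ (f i t) (f' 1 t) * ((α t).imI - (β t).imI) := by
    intro H t ht i hi
    have h₂ : ∀ t ∈ Icc (0 : ℝ) 1, inner ℝ (f 2 t) (γ.der 1 t) = 0 := fun t ht => by
      rw [hs₁ t ht 2 (by decide), h₂₀ t ht, (H t ht).1, sub_self]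
    have h₃ : ∀ t ∈ Icc (0 : ℝ) 1, inner ℝ (f 3 t) (γ.der 1 t) = 0 := fun t ht => by
      rw [hs₁ t ht 3 (by decide), h₃₀ t ht, (H t ht).2, sub_self]
    have hi' : ∀ t ∈ Icc (0 : ℝ) 1, inner ℝ (f i t) (γ.der 1 t) = 0 := by
      obtain rfl | rfl : i = 2 ∨ i = 3 := by omega
      · exact h₂
      · exact h₃
    rw [inner_der_succ ho hd hi' ht, Fin.sum_univ_four, h₂ t ht, h₃ t ht,
      ← hs₁ t ht i (by omega), hi' t ht, hs₁ t ht 1 (by decide), h₁₀ t ht]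
    ring
  refine ⟨⟨fun H => ?_, fun H t ht j => ?_⟩, fun H t ht => ?_⟩
  · have h₁ : ∀ t ∈ Icc (0 : ℝ) 1, (α t).imJ = (β t).imJ ∧ (α t).imK = (β t).imK := fun t ht => by
      have h₂ := (H t ht 1).2 2 (by decide)
      have h₃ := (H t ht 1).2 3 (by decide)
      change inner ℝ (f 2 t) (γ.der 1 t) = 0 at h₂
      change inner ℝ (f 3 t) (γ.der 1 t) = 0 at h₃
      rw [hs₁ t ht 2 (by decide), h₂₀ t ht] at h₂
      rw [hs₁ t ht 3 (by decide), h₃₀ t ht] at h₃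
      constructor <;> linarith
    intro t ht
    have h₂ := (H t ht 1).1
    have h₃ := (H t ht 2).1
    have h₄ := (H t ht 2).2 3 (by decide)
    change 0 < inner ℝ (f 1 t) (γ.der 1 t) at h₂
    change 0 < inner ℝ (f 2 t) (γ.der 2 t) at h₃
    change inner ℝ (f 3 t) (γ.der 2 t) = 0 at h₄
    rw [hs₁ t ht 1 (by decide), h₁₀ t ht] at h₂
    rw [hs₂ h₁ t ht 2 (by decide), h₂₁ t ht, mul_pos_iff_of_pos_right h₂] at h₃
    rw [hs₂ h₁ t ht 3 (by decide), h₃₁ t ht, mul_eq_zero, or_iff_left h₂.ne'] at h₄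
    have h₅ := h₁ t ht
    refine ⟨?_, ?_, h₅.2, ?_, ?_⟩ <;> linarith
  · have h₁ : ∀ t ∈ Icc (0 : ℝ) 1, (α t).imJ = (β t).imJ ∧ (α t).imK = (β t).imK := fun t ht =>
      ⟨(H t ht).1.trans (H t ht).2.1.symm, (H t ht).2.2.1⟩
    obtain ⟨hb, hb', hc, hc₀, ha⟩ := H t ht
    change 0 < inner ℝ (f j.castSucc t) (γ.der j t) ∧
      ∀ i, j.castSucc < i → inner ℝ (f i t) (γ.der j t) = 0
    fin_cases j
    · change 0 < inner ℝ (f 0 t) (γ.der 0 t) ∧ ∀ i, 0 < i → inner ℝ (f i t) (γ.der 0 t) = 0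
      exact ⟨by simp [hs₀ t ht], fun i hi => by simp [hs₀ t ht, hi.ne']⟩
    · change 0 < inner ℝ (f 1 t) (γ.der 1 t) ∧ ∀ i, 1 < i → inner ℝ (f i t) (γ.der 1 t) = 0
      refine ⟨?_, fun i hi => ?_⟩
      · rw [hs₁ t ht 1 (by decide), h₁₀ t ht]
        linarith
      · obtain rfl | rfl : i = 2 ∨ i = 3 := by omega
        · rw [hs₁ t ht 2 (by decide), h₂₀ t ht, hb, hb', sub_self]
        · rw [hs₁ t ht 3 (by decide), h₃₀ t ht, hc, sub_self]
    · change 0 < inner ℝ (f 2 t) (γ.der 2 t) ∧ ∀ i, 2 < i → inner ℝ (f i t) (γ.der 2 t) = 0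
      refine ⟨?_, fun i hi => ?_⟩
      · rw [hs₂ h₁ t ht 2 (by decide), h₂₁ t ht]
        exact mul_pos (by linarith) (by linarith)
      · obtain rfl : i = 3 := by omega
        rw [hs₂ h₁ t ht 3 (by decide), h₃₁ t ht, hb, hb']
        ring
  · have h₁ : ∀ t ∈ Icc (0 : ℝ) 1, (α t).imJ = (β t).imJ ∧ (α t).imK = (β t).imK := fun t ht =>
      ⟨(H t ht).1.trans (H t ht).2.1.symm, (H t ht).2.2.1⟩
    have h₃ : ∀ t ∈ Icc (0 : ℝ) 1, inner ℝ (f 3 t) (γ.der 2 t) = 0 := fun t ht => by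
      rw [hs₂ h₁ t ht 3 (by decide), h₃₁ t ht, (H t ht).1, (H t ht).2.1]
      ring
    change inner ℝ (f 3 t) (γ.der 3 t) = _
    rw [inner_der_succ ho hd h₃ ht, Fin.sum_univ_four, h₃ t ht, h₃₀ t ht, h₃₁ t ht, h₃₂ t ht,
      hs₂ h₁ t ht 2 (by decide), h₂₁ t ht, (H t ht).1, (H t ht).2.1, (H t ht).2.2.1]
    ring

end SphereCurve

/-! ### Continuous dependence of solutions of linear differential equations -/

/-- Curves of unit quaternions solving `q' = a q` with imaginary coefficients `a` depend continuously
on `a`: for two solutions, `q̄₀ q` has derivative `q̄₀ (a - a₀) q`. -/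
theorem continuous_of_linear_ode {X : Type*} [TopologicalSpace X] {a q : X → ℝ → ℍ[ℝ]}
    (ha : Continuous fun p : X × unitInterval => a p.1 p.2)
    (hre : ∀ x, ∀ t ∈ Icc (0 : ℝ) 1, (a x t).re = 0)
    (hn : ∀ x, ∀ t ∈ Icc (0 : ℝ) 1, ‖q x t‖ = 1) (h₀ : ∀ x, q x 0 = 1)
    (hd : ∀ x, ∀ t ∈ Icc (0 : ℝ) 1, HasDerivWithinAt (q x) (a x t * q x t) (Icc 0 1) t) :
    Continuous fun p : X × unitInterval => q p.1 p.2 := by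
  have hac : ∀ x, Continuous fun t : unitInterval => a x t := fun x =>
    ha.comp (Continuous.prodMk_right x)
  have hqc : ∀ x, Continuous fun t : unitInterval => q x t := fun x =>
    continuousOn_iff_continuous_domRestrict.1 fun t ht => (hd x t ht).continuousWithinAt
  rw [← continuous_ofFun_iff hqc, continuous_iff_continuousAt]
  rw [← continuous_ofFun_iff hac, continuous_iff_continuousAt] at ha
  intro x₀
  have ha₀ := ha x₀
  simp only [ContinuousAt, UniformFun.tendsto_iff_tendstoUniformly,
    Metric.tendstoUniformly_iff] at ha₀ ⊢
  intro ε hε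
  filter_upwards [ha₀ (ε / 2) (by positivity)] with x hx t
  have hx' : ∀ s ∈ Icc (0 : ℝ) 1, ‖a x s - a x₀ s‖ ≤ ε / 2 := fun s hs => by
    rw [← dist_eq_norm, dist_comm]
    exact (hx ⟨s, hs⟩).le
  have hu : ∀ s ∈ Icc (0 : ℝ) 1, HasDerivWithinAt (fun s => star (q x₀ s) * q x s)
      (star (q x₀ s) * (a x s - a x₀ s) * q x s) (Icc 0 1) s := fun s hs => by
    have hst : star (a x₀ s) = -a x₀ s := by ext <;> simp [hre x₀ s hs]
    refine ((hd x₀ s hs).star.mul (hd x s hs)).congr_deriv ?_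
    rw [star_mul, hst]
    noncomm_ring
  have hle := (convex_Icc (0 : ℝ) 1).norm_image_sub_le_of_norm_hasDerivWithin_le (C := ε / 2) hu
    (fun s hs => by
      rw [norm_mul, norm_mul, norm_star, hn x₀ s hs, hn x s hs, one_mul, mul_one]
      exact hx' s hs) (left_mem_Icc.2 zero_le_one) t.2
  have hqt : star (q x₀ t) * q x t - star (q x₀ 0) * q x 0 =
      star (q x₀ t) * (q x t - q x₀ t) := by
    rw [h₀, h₀, mul_sub, star_mul_self_of_norm (hn x₀ t t.2)]
    simp
  rw [hqt, norm_mul, norm_star, hn x₀ t t.2, one_mul, sub_zero, Real.norm_of_nonneg t.2.1] at hle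
  change dist (q x₀ t) (q x t) < ε
  rw [dist_comm, dist_eq_norm]
  have : ε / 2 * (t : ℝ) ≤ ε / 2 := mul_le_of_le_one_right (by positivity) t.2.2
  linarith
end

noncomputable section
open Set Quaternion

/-! ### Lifted Frenet frames -/

theorem differentiableOn_gramSchmidtNormed {E : Type*} [NormedAddCommGroup E]
    [InnerProductSpace ℝ E] {n : ℕ} {v : ℝ → Fin n → E} {s : Set ℝ}
    (hv : ∀ j, DifferentiableOn ℝ (fun t => v t j) s)
    (hli : ∀ t ∈ s, LinearIndependent ℝ (v t)) (j : Fin n) :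
    DifferentiableOn ℝ (fun t => InnerProductSpace.gramSchmidtNormed ℝ (v t) j) s := by
  have hne : ∀ j, ∀ t ∈ s, InnerProductSpace.gramSchmidt ℝ (v t) j ≠ 0 := fun j t ht =>
    InnerProductSpace.gramSchmidt_ne_zero j (hli t ht)
  have hg : ∀ j, DifferentiableOn ℝ (fun t => InnerProductSpace.gramSchmidt ℝ (v t) j) s := by
    intro j
    induction j using WellFoundedLT.induction with
    | ind j ih =>
      have h : ∀ t, InnerProductSpace.gramSchmidt ℝ (v t) j = v t j - ∑ i ∈ Finset.Iio j,
          (inner ℝ (InnerProductSpace.gramSchmidt ℝ (v t) i) (v t j) /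
            ‖InnerProductSpace.gramSchmidt ℝ (v t) i‖ ^ 2) •
              InnerProductSpace.gramSchmidt ℝ (v t) i := fun t =>
        eq_sub_of_add_eq (InnerProductSpace.gramSchmidt_def'' ℝ (v t) j).symm
      simp only [h]
      refine (hv j).sub (DifferentiableOn.fun_sum fun i hi => ?_)
      have hi' := ih i (Finset.mem_Iio.1 hi)
      exact ((hi'.inner ℝ (hv j)).div ((hi'.norm ℝ (hne i)).pow 2) fun t ht =>
        pow_ne_zero 2 (norm_ne_zero_iff.2 (hne i t ht))).smul hi'
  exact (((hg j).norm ℝ (hne j)).fun_inv fun t ht => norm_ne_zero_iff.2 (hne j t ht)).smul (hg j)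

namespace SphereCurve

theorem differentiableOn_der {n : ℕ} (γ : SphereCurve n) (k : ℕ) :
    DifferentiableOn ℝ (γ.der k) (Icc 0 1) := fun _ ht =>
  (γ.hasDerivWithinAt_der k ht).differentiableWithinAt

theorem inner_extend_der_one {n : ℕ} (γ : SphereCurve n) {t : ℝ} (ht : t ∈ Icc (0 : ℝ) 1) :
    inner ℝ (γ.extend t) (γ.der 1 t) = 0 := by
  have h₁ : HasDerivWithinAt γ.extend (γ.der 1 t) (Icc 0 1) t := by
    simpa [der_zero] using γ.hasDerivWithinAt_der 0 ht
  have h := (uniqueDiffOn_Icc (zero_lt_one' ℝ) t ht).eq_deriv _ (h₁.inner ℝ h₁)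
    ((hasDerivWithinAt_const t _ (1 : ℝ)).congr
      (fun s _ => by rw [real_inner_self_eq_norm_sq, γ.norm_extend, one_pow])
      (by rw [real_inner_self_eq_norm_sq, γ.norm_extend, one_pow]))
  rw [real_inner_comm (γ.extend t) (γ.der 1 t)] at h
  linarith

section

variable {m : ℕ} {γ : SphereCurve (m + 2)}
  {F : unitInterval → Matrix (Fin (m + 3)) (Fin (m + 3)) ℝ}

theorem gramSchmidt_der_zero (γ : SphereCurve (m + 2)) (t : unitInterval) :
    InnerProductSpace.gramSchmidt ℝ (fun k : Fin (m + 2) => γ.der k t) 0 = γ.extend t := by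
  have hI : Finset.Iio (0 : Fin (m + 2)) = ∅ := by
    ext i
    simp
  rw [InnerProductSpace.gramSchmidt_def, hI, Finset.sum_empty, sub_zero]
  exact congrFun γ.der_zero t

theorem IsFrenetFrame.euclideanCol_zero (h : γ.IsFrenetFrame F) (t : unitInterval) :
    (F t).euclideanCol 0 = γ.extend t := by
  have hg : InnerProductSpace.gramSchmidtNormed ℝ (fun k : Fin (m + 2) => γ.der k t) 0 =
      γ.extend t := by
    rw [InnerProductSpace.gramSchmidtNormed, γ.gramSchmidt_der_zero, γ.norm_extend]
    simp
  rw [← hg]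
  ext i
  exact (h t).2 i 0

theorem IsFrenetFrame.euclideanCol_one (h : γ.IsFrenetFrame F) (t : unitInterval) :
    (F t).euclideanCol 1 = γ.tangent t := by
  have hg : InnerProductSpace.gramSchmidt ℝ (fun k : Fin (m + 2) => γ.der k t) 1 =
      γ.der 1 t := by
    have h₁ := InnerProductSpace.gramSchmidt_def'' ℝ (fun k : Fin (m + 2) => γ.der k t) 1
    have hI : Finset.Iio (1 : Fin (m + 2)) = {0} := by
      ext i
      simp [Fin.lt_one_iff]
    rw [hI, Finset.sum_singleton, γ.gramSchmidt_der_zero] at h₁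
    have h₂ : inner ℝ (γ.extend t) (γ.der ((1 : Fin (m + 2)) : ℕ) t) = 0 :=
      γ.inner_extend_der_one t.2
    rw [h₂, zero_div, zero_smul, add_zero] at h₁
    exact h₁.symm
  have hgn : InnerProductSpace.gramSchmidtNormed ℝ (fun k : Fin (m + 2) => γ.der k t) 1 =
      γ.tangent t := by
    rw [InnerProductSpace.gramSchmidtNormed, hg]
    rfl
  rw [← hgn]
  ext i
  exact (h t).2 i 1

end

/-- All columns of the Frenet frame of a generic curve but the last are differentiable. -/
theorem IsFrenetFrame.differentiableOn {n : ℕ} {γ : SphereCurve n}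
    {F : unitInterval → Matrix (Fin (n + 1)) (Fin (n + 1)) ℝ} (h : γ.IsFrenetFrame F)
    (hg : γ.IsGeneric) (j : Fin n) :
    DifferentiableOn ℝ (IccExtend (zero_le_one' ℝ) fun t => (F t).euclideanCol j.castSucc)
      (Icc 0 1) := by
  refine (differentiableOn_gramSchmidtNormed (v := fun t (k : Fin n) => γ.der k t)
    (fun k => γ.differentiableOn_der k) (fun t ht => hg ⟨t, ht⟩) j).congr fun t ht => ?_
  rw [IccExtend_of_mem _ _ ht]
  ext i
  exact (h ⟨t, ht⟩).2 i j

end SphereCurve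

/-- A curve of unit quaternions as a map of a real variable. -/
def quaternionExtend (Γ : unitInterval → UnitQuaternion) : ℝ → ℍ[ℝ] :=
  IccExtend (zero_le_one' ℝ) fun t => (Γ t : ℍ[ℝ])

theorem quaternionExtend_coe (Γ : unitInterval → UnitQuaternion) (t : unitInterval) :
    quaternionExtend Γ t = Γ t := IccExtend_val _ _ _

theorem norm_quaternionExtend (Γ : unitInterval → UnitQuaternion) (t : ℝ) :
    ‖quaternionExtend Γ t‖ = 1 := norm_unitQuaternion _

theorem continuous_quaternionExtend {Γ : unitInterval → UnitQuaternion} (hΓ : Continuous Γ) :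
    Continuous (quaternionExtend Γ) :=
  (continuous_subtype_val.comp hΓ).Icc_extend'

namespace SphereCurve

section

variable {γ : SphereCurve 2} {Γ : unitInterval → UnitQuaternion}

theorem IsLiftedFrame.extend_eq₂ (h : IsLiftedFrame spinProj3 γ Γ) {t : ℝ}
    (ht : t ∈ Icc (0 : ℝ) 1) :
    γ.extend t =
      imL (quaternionExtend Γ t * quaternionBasis 1 * star (quaternionExtend Γ t)) := by
  lift t to unitInterval using ht
  rw [quaternionExtend_coe, ← h.2.2.euclideanCol_zero t, euclideanCol_spinProj3]
  rfl

theorem IsLiftedFrame.tangent_eq₂ (h : IsLiftedFrame spinProj3 γ Γ) {t : ℝ}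
    (ht : t ∈ Icc (0 : ℝ) 1) :
    γ.tangent t =
      imL (quaternionExtend Γ t * quaternionBasis 2 * star (quaternionExtend Γ t)) := by
  lift t to unitInterval using ht
  rw [quaternionExtend_coe, ← h.2.2.euclideanCol_one t, euclideanCol_spinProj3]
  rfl

theorem ofImL_extend (h : IsLiftedFrame spinProj3 γ Γ) {t : ℝ} (ht : t ∈ Icc (0 : ℝ) 1) :
    ofImL (γ.extend t) =
      quaternionExtend Γ t * quaternionBasis 1 * star (quaternionExtend Γ t) := by
  rw [h.extend_eq₂ ht, ofImL_imL]
  rw [re_mul_mul_star (norm_quaternionExtend Γ t)]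
  rfl

theorem ofImL_tangent (h : IsLiftedFrame spinProj3 γ Γ) {t : ℝ} (ht : t ∈ Icc (0 : ℝ) 1) :
    ofImL (γ.tangent t) =
      quaternionExtend Γ t * quaternionBasis 2 * star (quaternionExtend Γ t) := by
  rw [h.tangent_eq₂ ht, ofImL_imL]
  rw [re_mul_mul_star (norm_quaternionExtend Γ t)]
  rfl

/-- A curve in `𝕊²` has at most one lifted Frenet frame curve. -/
theorem IsLiftedFrame.unique {Δ : unitInterval → UnitQuaternion}
    (h : IsLiftedFrame spinProj3 γ Γ) (h' : IsLiftedFrame spinProj3 γ Δ) : Γ = Δ := by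
  refine eq_of_mul_quaternionBasis_eq h.1 h'.1 (h.2.1.trans h'.2.1.symm) fun t k hk => ?_
  rw [← quaternionExtend_coe, ← quaternionExtend_coe]
  rcases hk with rfl | rfl
  · rw [← ofImL_extend h t.2, ← ofImL_extend h' t.2]
  · rw [← ofImL_tangent h t.2, ← ofImL_tangent h' t.2]

/-- The curve `h ↦ z h z̄` of rotations is the Frenet frame of `γ = z 𝐢 z̄` if and only if the
logarithmic derivative of `z` is `a 𝐢 + c 𝐤` with `c > 0`. -/
theorem isGeneric_and_isFrenetFrame_spinProj3_iff {α : ℝ → ℍ[ℝ]}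
    (h : IsSpinCurve (quaternionExtend Γ) α)
    (hγ : ∀ t ∈ Icc (0 : ℝ) 1, γ.extend t =
      imL (quaternionExtend Γ t * quaternionBasis 1 * star (quaternionExtend Γ t))) :
    (γ.IsGeneric ∧ γ.IsFrenetFrame fun t => spinProj3 (Γ t)) ↔
      ∀ t ∈ Icc (0 : ℝ) 1, (α t).imJ = 0 ∧ 0 < (α t).imK := by
  rw [← (frenet_iff_of_isSpinCurve h hγ).1, isGeneric_and_isFrenetFrame_iff,
    and_iff_right fun t => spinProj3_mem (Γ t)]
  simp only [euclideanCol_spinProj3, ← quaternionExtend_coe]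
  exact ⟨fun H t ht => H ⟨t, ht⟩, fun H t => H t t.2⟩

theorem IsLiftedFrame.exists_isSpinCurve₂ (h : IsLiftedFrame spinProj3 γ Γ) (hg : γ.IsGeneric) :
    ∃ α, IsSpinCurve (quaternionExtend Γ) α ∧
      ∀ t ∈ Icc (0 : ℝ) 1, (α t).imJ = 0 ∧ 0 < (α t).imK := by
  have hj : ∀ j : Fin 2, DifferentiableOn ℝ (fun t => quaternionExtend Γ t *
      quaternionBasis j.castSucc.succ * star (quaternionExtend Γ t)) (Icc 0 1) := fun j => by
    refine (ofImL.differentiable.comp_differentiableOn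
      (h.2.2.differentiableOn hg j)).congr fun t ht => ?_
    rw [Function.comp_apply, IccExtend_of_mem _ _ ht, euclideanCol_spinProj3, ofImL_imL]
    · rw [quaternionExtend, IccExtend_of_mem _ _ ht]
    · rw [re_mul_mul_star (norm_unitQuaternion _), re_quaternionBasis_succ]
  obtain ⟨α, hα⟩ := exists_isSpinCurve (continuous_quaternionExtend h.1).continuousOn
    (fun t _ => norm_quaternionExtend Γ t) (hj 0) (hj 1)
  exact ⟨α, hα, (isGeneric_and_isFrenetFrame_spinProj3_iff hα fun t ht => h.extend_eq₂ ht).1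
    ⟨hg, h.2.2⟩⟩

end

section

variable {γ : SphereCurve 3} {Γ Δ : unitInterval → UnitQuaternion}

theorem IsLiftedFrame.extend_eq₃ (h : IsLiftedFrame spinProj4 γ fun t => (Γ t, Δ t)) {t : ℝ}
    (ht : t ∈ Icc (0 : ℝ) 1) :
    γ.extend t =
      linearIsometryEquivTuple (quaternionExtend Γ t * star (quaternionExtend Δ t)) := by
  lift t to unitInterval using ht
  rw [quaternionExtend_coe, quaternionExtend_coe, ← h.2.2.euclideanCol_zero t,
    euclideanCol_spinProj4, quaternionBasis_zero, mul_one]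

theorem IsLiftedFrame.tangent_eq₃ (h : IsLiftedFrame spinProj4 γ fun t => (Γ t, Δ t)) {t : ℝ}
    (ht : t ∈ Icc (0 : ℝ) 1) :
    γ.tangent t = linearIsometryEquivTuple
      (quaternionExtend Γ t * quaternionBasis 1 * star (quaternionExtend Δ t)) := by
  lift t to unitInterval using ht
  rw [quaternionExtend_coe, quaternionExtend_coe, ← h.2.2.euclideanCol_one t,
    euclideanCol_spinProj4]

/-- The curve `q ↦ z q w̄` of rotations is the Frenet frame of `γ = z w̄` if and only if the
logarithmic derivatives of `z` and `w` are `a 𝐢 + c 𝐤` and `a' 𝐢 + c 𝐤` with `c > 0`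
and `a > a'`. -/
theorem isGeneric_and_isFrenetFrame_spinProj4_iff {α β : ℝ → ℍ[ℝ]}
    (hz : IsSpinCurve (quaternionExtend Γ) α) (hw : IsSpinCurve (quaternionExtend Δ) β)
    (hγ : ∀ t ∈ Icc (0 : ℝ) 1, γ.extend t =
      linearIsometryEquivTuple (quaternionExtend Γ t * star (quaternionExtend Δ t))) :
    (γ.IsGeneric ∧ γ.IsFrenetFrame fun t => spinProj4 (Γ t, Δ t)) ↔
      ∀ t ∈ Icc (0 : ℝ) 1, (α t).imJ = 0 ∧ (β t).imJ = 0 ∧ (α t).imK = (β t).imK ∧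
        0 < (α t).imK ∧ (β t).imI < (α t).imI := by
  rw [← (frenet_iff_of_isSpinCurve_pair hz hw hγ).1, isGeneric_and_isFrenetFrame_iff,
    and_iff_right fun t => spinProj4_mem (Γ t) (Δ t)]
  simp only [euclideanCol_spinProj4, ← quaternionExtend_coe]
  exact ⟨fun H t ht => H ⟨t, ht⟩, fun H t => H t t.2⟩

theorem IsLiftedFrame.exists_isSpinCurve₃ (h : IsLiftedFrame spinProj4 γ fun t => (Γ t, Δ t))
    (hg : γ.IsGeneric) :
    ∃ α β, IsSpinCurve (quaternionExtend Γ) α ∧ IsSpinCurve (quaternionExtend Δ) β ∧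
      ∀ t ∈ Icc (0 : ℝ) 1, (α t).imJ = 0 ∧ (β t).imJ = 0 ∧ (α t).imK = (β t).imK ∧
        0 < (α t).imK ∧ (β t).imI < (α t).imI := by
  set z := quaternionExtend Γ with hz
  set w := quaternionExtend Δ with hw
  have hzn : ∀ t, ‖z t‖ = 1 := norm_quaternionExtend Γ
  have hwn : ∀ t, ‖w t‖ = 1 := norm_quaternionExtend Δ
  have hj : ∀ j : Fin 3, DifferentiableOn ℝ (fun t => z t *
      quaternionBasis j.castSucc * star (w t)) (Icc 0 1) := fun j => by
    refine (linearIsometryEquivTuple.symm.differentiable.comp_differentiableOn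
      (h.2.2.differentiableOn hg j)).congr fun t ht => ?_
    rw [Function.comp_apply, IccExtend_of_mem _ _ ht, euclideanCol_spinProj4,
      LinearIsometryEquiv.symm_apply_apply, hz, hw, quaternionExtend, IccExtend_of_mem _ _ ht,
      quaternionExtend, IccExtend_of_mem _ _ ht]
  have h₀ : DifferentiableOn ℝ (fun t => z t * star (w t)) (Icc 0 1) :=
    (hj 0).congr fun t _ => by
      change _ = z t * quaternionBasis 0 * _
      rw [quaternionBasis_zero, mul_one]
  have hl : ∀ j : Fin 3, DifferentiableOn ℝ (fun t => z t *
      quaternionBasis j.castSucc * star (z t)) (Icc 0 1) := fun j =>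
    ((hj j).mul h₀.star).congr fun t _ => by
      simp only [Pi.mul_apply, star_mul, star_star, ← mul_assoc]
      rw [mul_assoc _ (star (w t)), star_mul_self_of_norm (hwn t), mul_one]
  have hr : ∀ j : Fin 3, DifferentiableOn ℝ (fun t => w t *
      quaternionBasis j.castSucc * star (w t)) (Icc 0 1) := fun j =>
    (h₀.star.mul (hj j)).congr fun t _ => by
      simp only [Pi.mul_apply, star_mul, star_star, ← mul_assoc]
      rw [mul_assoc _ (star (z t)), star_mul_self_of_norm (hzn t), mul_one]
  obtain ⟨α, hα⟩ := exists_isSpinCurve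
    (continuous_quaternionExtend (continuous_fst.comp h.1)).continuousOn
    (fun t _ => hzn t) (hl 1) (hl 2)
  obtain ⟨β, hβ⟩ := exists_isSpinCurve
    (continuous_quaternionExtend (continuous_snd.comp h.1)).continuousOn
    (fun t _ => hwn t) (hr 1) (hr 2)
  exact ⟨α, β, hα, hβ, (isGeneric_and_isFrenetFrame_spinProj4_iff hα hβ
    fun t ht => h.extend_eq₃ ht).1 ⟨hg, h.2.2⟩⟩

end

end SphereCurve
end

noncomputable section
open Set Quaternion

/-! ### Differential relations between a curve in `𝕊³` and its pair of curves in `𝕊²` -/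

namespace SphereCurve

variable {X : Type*} [TopologicalSpace X]

theorem isSmoothFamily_extend {n : ℕ} {γ : X → SphereCurve n} (hγ : Continuous γ) :
    IsSmoothFamily fun x => (γ x).extend := continuous_iff_isSmoothFamily.1 hγ

theorem isSmoothFamily_tangent {n : ℕ} {γ : X → SphereCurve n} (hγ : Continuous γ)
    (h₀ : ∀ x, ∀ t ∈ Icc (0 : ℝ) 1, (γ x).der 1 t ≠ 0) : IsSmoothFamily fun x => (γ x).tangent :=
  ((isSmoothFamily_der 1).comp hγ).normalize h₀

theorem IsGeneric.der_one_ne_zero {m : ℕ} {γ : SphereCurve (m + 2)} (h : γ.IsGeneric) {t : ℝ}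
    (ht : t ∈ Icc (0 : ℝ) 1) : γ.der 1 t ≠ 0 := (h ⟨t, ht⟩).ne_zero 1

/-- The curve `𝐭 γ̄` in the imaginary quaternions, for a curve `γ` in `𝕊³` with unit tangent
vector `𝐭`. If `γ = z w̄` and `𝐭 = z 𝐢 w̄`, then it is `z 𝐢 z̄`. -/
def leftCurve (γ : SphereCurve 3) (t : ℝ) : EuclideanSpace ℝ (Fin 3) :=
  imL (linearIsometryEquivTuple.symm (γ.tangent t) *
    star (linearIsometryEquivTuple.symm (γ.extend t)))

/-- The curve `γ̄ 𝐭` in the imaginary quaternions, for a curve `γ` in `𝕊³` with unit tangent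
vector `𝐭`. If `γ = z w̄` and `𝐭 = z 𝐢 w̄`, then it is `w 𝐢 w̄`. -/
def rightCurve (γ : SphereCurve 3) (t : ℝ) : EuclideanSpace ℝ (Fin 3) :=
  imL (star (linearIsometryEquivTuple.symm (γ.extend t)) *
    linearIsometryEquivTuple.symm (γ.tangent t))

/-- Conjugation of quaternions as a continuous linear map. -/
def starL : ℍ[ℝ] →L[ℝ] ℍ[ℝ] := (starL' ℝ : ℍ[ℝ] ≃L[ℝ] ℍ[ℝ])

/-- The coordinates `ℝ⁴ → ℍ` as a continuous linear map. -/
def ofTupleL : EuclideanSpace ℝ (Fin 4) →L[ℝ] ℍ[ℝ] :=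
  (linearIsometryEquivTuple.symm.toContinuousLinearEquiv : _ →L[ℝ] ℍ[ℝ])

theorem isSmoothFamily_leftCurve {γ : X → SphereCurve 3} (hγ : Continuous γ)
    (h₀ : ∀ x, ∀ t ∈ Icc (0 : ℝ) 1, (γ x).der 1 t ≠ 0) :
    IsSmoothFamily fun x => (γ x).leftCurve :=
  (((isSmoothFamily_tangent hγ h₀).clm ofTupleL).mul
    (((isSmoothFamily_extend hγ).clm ofTupleL).clm starL)).clm imL

theorem isSmoothFamily_rightCurve {γ : X → SphereCurve 3} (hγ : Continuous γ)
    (h₀ : ∀ x, ∀ t ∈ Icc (0 : ℝ) 1, (γ x).der 1 t ≠ 0) :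
    IsSmoothFamily fun x => (γ x).rightCurve :=
  ((((isSmoothFamily_extend hγ).clm ofTupleL).clm starL).mul
    ((isSmoothFamily_tangent hγ h₀).clm ofTupleL)).clm imL

/-- The rate of rotation `𝐭' ⬝ 𝐧 = κ ‖γ'‖` of the unit tangent vector of a curve in `𝕊²`. -/
def turning (γ : SphereCurve 2) (t : ℝ) : ℝ :=
  inner ℝ (derivWithin γ.tangent (Icc 0 1) t) (γ.normal t)

theorem isSmoothFamily_turning {γ : X → SphereCurve 2} (hγ : Continuous γ)
    (h₀ : ∀ x, ∀ t ∈ Icc (0 : ℝ) 1, (γ x).der 1 t ≠ 0) :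
    IsSmoothFamily fun x => (γ x).turning := by
  have ht := isSmoothFamily_tangent hγ h₀
  have hn : IsSmoothFamily fun x => (γ x).normal := by
    refine ((((isSmoothFamily_extend hγ).clm ofImL).mul (ht.clm ofImL)).clm imL).congr
      fun x t _ => ?_
    rw [← toLp_crossProduct_imL _ _ rfl rfl, imL_ofImL, imL_ofImL]
    rfl
  exact ht.derivWithin.bilin hn (innerSL ℝ)

/-- The coefficient of the linear differential equation `q' = a q` that is satisfied by the curve
`q = z w̄` in `𝕊³` defined by two curves `z 𝐢 z̄` and `w 𝐢 w̄` in `𝕊²`. -/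
def odeCoeff (p : SphereCurve 2 × SphereCurve 2) (t : ℝ) : ℍ[ℝ] :=
  ((p.1.turning t - p.2.turning t) / 2) • ofImL (p.1.extend t)

theorem isSmoothFamily_odeCoeff {p : X → SphereCurve 2 × SphereCurve 2} (hp : Continuous p)
    (h₁ : ∀ x, (p x).1.IsGeneric) (h₂ : ∀ x, (p x).2.IsGeneric) :
    IsSmoothFamily fun x => odeCoeff (p x) := by
  have hl := isSmoothFamily_turning (continuous_fst.comp hp) fun x t ht =>
    IsGeneric.der_one_ne_zero (m := 0) (h₁ x) ht
  have hr := isSmoothFamily_turning (continuous_snd.comp hp) fun x t ht =>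
    IsGeneric.der_one_ne_zero (m := 0) (h₂ x) ht
  refine (((hl.clm ((1 / 2 : ℝ) • ContinuousLinearMap.id ℝ ℝ)).add
    (hr.clm ((-1 / 2 : ℝ) • ContinuousLinearMap.id ℝ ℝ))).smul
      ((isSmoothFamily_extend (continuous_fst.comp hp)).clm ofImL)).congr fun x t _ => ?_
  rw [odeCoeff]
  congr 1
  simp
  ring

theorem re_odeCoeff (p : SphereCurve 2 × SphereCurve 2) (t : ℝ) : (odeCoeff p t).re = 0 := by
  rw [odeCoeff, re_smul]
  exact mul_zero _

section

variable {p : SphereCurve 2 × SphereCurve 2} {Γl Γr : unitInterval → UnitQuaternion}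

/-- The data of a pair of curves in terms of the logarithmic derivatives `α = a 𝐢 + c 𝐤` and
`β = a' 𝐢 + c 𝐤` of their lifted frames. -/
theorem exists_isSpinCurve_of_pair (hl : IsLiftedFrame spinProj3 p.1 Γl)
    (hr : IsLiftedFrame spinProj3 p.2 Γr) (h₁ : p.1.IsGeneric) (h₂ : p.2.IsGeneric)
    (hs : ∀ t ∈ Icc (0 : ℝ) 1, ‖p.1.der 1 t‖ = ‖p.2.der 1 t‖) :
    ∃ α β, IsSpinCurve (quaternionExtend Γl) α ∧ IsSpinCurve (quaternionExtend Γr) β ∧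
      ∀ t ∈ Icc (0 : ℝ) 1, (α t).imJ = 0 ∧ (β t).imJ = 0 ∧ (α t).imK = (β t).imK ∧
        0 < (α t).imK ∧ p.1.turning t = 2 * (α t).imI ∧ p.2.turning t = 2 * (β t).imI := by
  obtain ⟨α, hα, hα'⟩ := hl.exists_isSpinCurve₂ h₁
  obtain ⟨β, hβ, hβ'⟩ := hr.exists_isSpinCurve₂ h₂
  refine ⟨α, β, hα, hβ, fun t ht => ?_⟩
  have hl' := speed_tangent_of_isSpinCurve hα (fun t ht => hl.extend_eq₂ ht) hα' ht
  have hr' := speed_tangent_of_isSpinCurve hβ (fun t ht => hr.extend_eq₂ ht) hβ' ht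
  refine ⟨(hα' t ht).1, (hβ' t ht).1, ?_, (hα' t ht).2, hl'.2, hr'.2⟩
  have := hs t ht
  rw [hl'.1, hr'.1] at this
  linarith

/-- The logarithmic derivatives of `z` and `w` differ by a multiple of `𝐢`, so `q = z w̄` satisfies
a differential equation whose coefficients involve only the curves and not their lifts. -/
theorem hasDerivWithinAt_mul_star (hl : IsLiftedFrame spinProj3 p.1 Γl)
    (hr : IsLiftedFrame spinProj3 p.2 Γr) (h₁ : p.1.IsGeneric) (h₂ : p.2.IsGeneric)
    (hs : ∀ t ∈ Icc (0 : ℝ) 1, ‖p.1.der 1 t‖ = ‖p.2.der 1 t‖) {t : ℝ}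
    (ht : t ∈ Icc (0 : ℝ) 1) :
    HasDerivWithinAt (fun t => quaternionExtend Γl t * star (quaternionExtend Γr t))
      (odeCoeff p t * (quaternionExtend Γl t * star (quaternionExtend Γr t))) (Icc 0 1) t := by
  obtain ⟨α, β, hα, hβ, h⟩ := exists_isSpinCurve_of_pair hl hr h₁ h₂ hs
  obtain ⟨hb, hb', hc, -, ha, ha'⟩ := h t ht
  have hd := hα.hasDerivWithinAt_mul_mul_star hβ 1 ht
  simp only [mul_one, one_mul] at hd
  refine hd.congr_deriv ?_
  have h₃ : α t - β t = ((α t).imI - (β t).imI) • quaternionBasis 1 := by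
    ext <;> simp [re_quaternionBasis, imI_quaternionBasis, imJ_quaternionBasis,
      imK_quaternionBasis, hα.re_eq t ht, hβ.re_eq t ht, hb, hb', hc]
  rw [h₃, odeCoeff, ofImL_extend hl ht, ha, ha', smul_mul_assoc, mul_smul_comm, smul_mul_assoc]
  congr 1
  · ring
  · simp only [mul_assoc]
    rw [← mul_assoc (star _) (quaternionExtend Γl t),
      star_mul_self_of_norm (norm_quaternionExtend _ _), one_mul]

end

end SphereCurve

open SphereCurve

/-- The curve `γ` in `𝕊³` and the pair `p` of curves in `𝕊²` have lifted Frenet frames that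
correspond to each other, with given end points. -/
def HaveCommonLift (zl zr : UnitQuaternion) (γ : SphereCurve 3)
    (p : SphereCurve 2 × SphereCurve 2) : Prop :=
  ∃ Γl Γr : unitInterval → UnitQuaternion,
    IsLiftedFrame spinProj3 p.1 Γl ∧ IsLiftedFrame spinProj3 p.2 Γr ∧
    IsLiftedFrame spinProj4 γ (fun t => (Γl t, Γr t)) ∧ Γl 1 = zl ∧ Γr 1 = zr

/-! ### The bijection and its continuity -/

section

variable {zl zr : UnitQuaternion} {γ δ : SphereCurve 3} {p p' : SphereCurve 2 × SphereCurve 2}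

theorem SphereCurve.ext_of_extend {n : ℕ} {γ δ : SphereCurve n}
    (h : ∀ t ∈ Icc (0 : ℝ) 1, γ.extend t = δ.extend t) : γ = δ := by
  ext1
  funext t
  ext1
  simpa [extend] using h t t.2

theorem SphereCurve.IsLiftedFrame.leftCurve_eq_and_rightCurve_eq {Γl Γr : unitInterval → UnitQuaternion}
    (h : IsLiftedFrame spinProj4 γ (fun t => (Γl t, Γr t))) {t : ℝ} (ht : t ∈ Icc (0 : ℝ) 1) :
    γ.leftCurve t = imL (quaternionExtend Γl t * quaternionBasis 1 *
        star (quaternionExtend Γl t)) ∧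
      γ.rightCurve t = imL (quaternionExtend Γr t * quaternionBasis 1 *
        star (quaternionExtend Γr t)) := by
  rw [leftCurve, rightCurve, h.extend_eq₃ ht, h.tangent_eq₃ ht,
    LinearIsometryEquiv.symm_apply_apply, LinearIsometryEquiv.symm_apply_apply, star_mul, star_star]
  constructor
  · have := mul_mul_star_mul (norm_quaternionExtend Γr t) (quaternionExtend Γl t)
      (quaternionBasis 1) 1 (quaternionExtend Γl t)
    simp only [mul_one] at this
    rw [this]
  · have := mul_mul_star_mul (norm_quaternionExtend Γl t) (quaternionExtend Γr t) 1
      (quaternionBasis 1) (quaternionExtend Γr t)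
    simp only [mul_one, one_mul] at this
    rw [this]

theorem HaveCommonLift.extend_eq (h : HaveCommonLift zl zr γ p) {t : ℝ}
    (ht : t ∈ Icc (0 : ℝ) 1) :
    p.1.extend t = γ.leftCurve t ∧ p.2.extend t = γ.rightCurve t := by
  obtain ⟨Γl, Γr, hl, hr, h, -, -⟩ := h
  rw [(h.leftCurve_eq_and_rightCurve_eq ht).1, (h.leftCurve_eq_and_rightCurve_eq ht).2]
  exact ⟨hl.extend_eq₂ ht, hr.extend_eq₂ ht⟩

theorem HaveCommonLift.right_unique (h : HaveCommonLift zl zr γ p)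
    (h' : HaveCommonLift zl zr γ p') : p = p' :=
  Prod.ext
    (ext_of_extend fun _ ht => (h.extend_eq ht).1.trans (h'.extend_eq ht).1.symm)
    (ext_of_extend fun _ ht => (h.extend_eq ht).2.trans (h'.extend_eq ht).2.symm)

theorem HaveCommonLift.left_unique (h : HaveCommonLift zl zr γ p)
    (h' : HaveCommonLift zl zr δ p) : γ = δ := by
  obtain ⟨Γl, Γr, hl, hr, h, -, -⟩ := h
  obtain ⟨Δl, Δr, hl', hr', h', -, -⟩ := h'
  obtain rfl := hl.unique hl'
  obtain rfl := hr.unique hr'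
  exact ext_of_extend fun t ht => (h.extend_eq₃ ht).trans (h'.extend_eq₃ ht).symm

/-- A smooth curve on `[0,1]` with values in the unit sphere, as an element of the space of
spherical curves. -/
theorem exists_sphereCurve {n : ℕ} {f : ℝ → EuclideanSpace ℝ (Fin (n + 1))}
    (hf : ContDiffOn ℝ ∞ f (Icc 0 1)) (hn : ∀ t ∈ Icc (0 : ℝ) 1, ‖f t‖ = 1) :
    ∃ γ : SphereCurve n, ∀ t ∈ Icc (0 : ℝ) 1, γ.extend t = f t := by
  have he : ∀ t ∈ Icc (0 : ℝ) 1,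
      IccExtend (zero_le_one' ℝ) (fun t : unitInterval => f t) t = f t := fun t ht =>
    IccExtend_of_mem _ _ ht
  exact ⟨⟨fun t => ⟨f t, by simpa using hn t t.2⟩, hf.congr he⟩, he⟩

/-- Every locally convex curve in `𝕊³` has a pair of curves in `𝕊²`: with logarithmic derivatives
`a 𝐢 + c 𝐤` and `a' 𝐢 + c 𝐤` of the two components of its lifted frame, the pair has common
speed `2 c` and curvatures `a / c` and `a' / c`, while the sign of `a + a'` is the sign of
`det (γ, γ', γ'', γ''')`. -/
theorem exists_pair (hγ : γ ∈ LS3 zl zr) :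
    ∃ p ∈ curvePairs zl zr, HaveCommonLift zl zr γ p := by
  obtain ⟨hconv, Γ, hΓ, hΓ₁⟩ := hγ
  have hg := hconv.isGeneric
  set Γl : unitInterval → UnitQuaternion := fun t => (Γ t).1
  set Γr : unitInterval → UnitQuaternion := fun t => (Γ t).2
  have hlift : IsLiftedFrame spinProj4 γ (fun t => (Γl t, Γr t)) := hΓ
  obtain ⟨α, β, hα, hβ, h⟩ := hlift.exists_isSpinCurve₃ hg
  have hsum : ∀ t ∈ Icc (0 : ℝ) 1, 0 < (α t).imI + (β t).imI := fun t ht => by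
    have h₁ := (isLocallyConvex_iff hg hlift.2.2).1 hconv ⟨t, ht⟩
    have h₂ := (frenet_iff_of_isSpinCurve_pair hα hβ fun t ht => hlift.extend_eq₃ ht).2 h t ht
    rw [euclideanCol_spinProj4, ← quaternionExtend_coe, ← quaternionExtend_coe] at h₁
    have h₃ := h₂ ▸ h₁
    exact (mul_pos_iff_of_pos_right (mul_pos (by linarith [(h t ht).2.2.2.1])
      (by linarith [(h t ht).2.2.2.2]))).1 h₃
  have hd₀ : ∀ (_ : Unit), ∀ t ∈ Icc (0 : ℝ) 1, γ.der 1 t ≠ 0 := fun _ t ht =>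
    IsGeneric.der_one_ne_zero (m := 1) hg ht
  have hnorm : ∀ (Δ : unitInterval → UnitQuaternion) (t : ℝ), ‖imL (quaternionExtend Δ t *
      quaternionBasis 1 * star (quaternionExtend Δ t))‖ = 1 := fun Δ t => by
    have hn := norm_quaternionExtend Δ t
    rw [norm_imL, norm_mul_mul_star hn hn, norm_quaternionBasis]
    rw [re_mul_mul_star hn]
    rfl
  obtain ⟨γl, hγl⟩ := exists_sphereCurve
    ((isSmoothFamily_leftCurve (continuous_const (y := γ)) hd₀).contDiffOn ())
    fun t ht => by rw [(hlift.leftCurve_eq_and_rightCurve_eq ht).1, hnorm]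
  obtain ⟨γr, hγr⟩ := exists_sphereCurve
    ((isSmoothFamily_rightCurve (continuous_const (y := γ)) hd₀).contDiffOn ())
    fun t ht => by rw [(hlift.leftCurve_eq_and_rightCurve_eq ht).2, hnorm]
  have hγl' := fun t ht => (hγl t ht).trans (hlift.leftCurve_eq_and_rightCurve_eq ht).1
  have hγr' := fun t ht => (hγr t ht).trans (hlift.leftCurve_eq_and_rightCurve_eq ht).2
  have hl : ∀ t ∈ Icc (0 : ℝ) 1, (α t).imJ = 0 ∧ 0 < (α t).imK := fun t ht =>
    ⟨(h t ht).1, (h t ht).2.2.2.1⟩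
  have hr : ∀ t ∈ Icc (0 : ℝ) 1, (β t).imJ = 0 ∧ 0 < (β t).imK := fun t ht =>
    ⟨(h t ht).2.1, (h t ht).2.2.1 ▸ (h t ht).2.2.2.1⟩
  obtain ⟨hgl, hFl⟩ := (isGeneric_and_isFrenetFrame_spinProj3_iff hα hγl').2 hl
  obtain ⟨hgr, hFr⟩ := (isGeneric_and_isFrenetFrame_spinProj3_iff hβ hγr').2 hr
  have hLl : IsLiftedFrame spinProj3 γl Γl :=
    ⟨continuous_fst.comp hΓ.1, congrArg Prod.fst hΓ.2.1, hFl⟩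
  have hLr : IsLiftedFrame spinProj3 γr Γr :=
    ⟨continuous_snd.comp hΓ.1, congrArg Prod.snd hΓ.2.1, hFr⟩
  have hzl : Γl 1 = zl := congrArg Prod.fst hΓ₁
  have hzr : Γr 1 = zr := congrArg Prod.snd hΓ₁
  refine ⟨(γl, γr), ⟨⟨?_, Γl, hLl, hzl⟩, ⟨hgr, Γr, hLr, hzr⟩, fun t => ?_⟩,
    Γl, Γr, hLl, hLr, hlift, hzl, hzr⟩
  · refine (isLocallyConvex_iff hgl hFl).2 fun t => ?_
    have h₂ := (frenet_iff_of_isSpinCurve hα hγl').2 hl t t.2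
    rw [euclideanCol_spinProj3, ← quaternionExtend_coe]
    refine lt_of_lt_of_eq ?_ h₂.symm
    exact mul_pos (by linarith [hsum t t.2, (h t t.2).2.2.2.2]) (hl t t.2).2
  · obtain ⟨hsl, htl⟩ := speed_tangent_of_isSpinCurve hα hγl' hl t.2
    obtain ⟨hsr, htr⟩ := speed_tangent_of_isSpinCurve hβ hγr' hr t.2
    have hc := (h t t.2).2.2.1
    refine ⟨by rw [hsl, hsr, hc], ?_⟩
    change |γr.geodesicCurvature t| < γl.geodesicCurvature t
    have hpos := (hr t t.2).2
    rw [geodesicCurvature, geodesicCurvature, htl, htr, hsl, hsr, hc, abs_div,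
      abs_of_pos (by linarith : 0 < 2 * (β t).imK)]
    refine div_lt_div_of_pos_right (abs_lt.2 ⟨?_, ?_⟩) (by linarith)
    · linarith [hsum t t.2]
    · linarith [(h t t.2).2.2.2.2]

/-- Every pair of curves comes from a locally convex curve in `𝕊³`, namely `z w̄` for the lifted
frames `z` and `w` of the pair. -/
theorem exists_curve (hp : p ∈ curvePairs zl zr) :
    ∃ γ ∈ LS3 zl zr, HaveCommonLift zl zr γ p := by
  obtain ⟨⟨hconv, Γl, hl, hl₁⟩, ⟨hgr, Γr, hr, hr₁⟩, hκ⟩ := hp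
  have hgl := hconv.isGeneric
  have hs : ∀ t ∈ Icc (0 : ℝ) 1, ‖p.1.der 1 t‖ = ‖p.2.der 1 t‖ := fun t ht => (hκ ⟨t, ht⟩).1
  obtain ⟨α, β, hα, hβ, h⟩ := exists_isSpinCurve_of_pair hl hr hgl hgr hs
  have hlt : ∀ t ∈ Icc (0 : ℝ) 1, |(β t).imI| < (α t).imI := fun t ht => by
    have h₁ := (hκ ⟨t, ht⟩).2
    have h₂ := norm_pos_iff.2 (IsGeneric.der_one_ne_zero (m := 0) hgl ht)
    change |p.2.turning t / ‖p.2.der 1 t‖| < p.1.turning t / ‖p.1.der 1 t‖ at h₁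
    rw [← hs t ht, abs_div, abs_of_pos h₂, div_lt_div_iff_of_pos_right h₂,
      (h t ht).2.2.2.2.1, (h t ht).2.2.2.2.2, abs_mul, abs_of_pos (zero_lt_two' ℝ)] at h₁
    linarith
  have hsm : IsSmoothFamily fun (_ : Unit) t =>
      quaternionExtend Γl t * star (quaternionExtend Γr t) :=
    IsSmoothFamily.of_linear_ode
      (isSmoothFamily_odeCoeff (continuous_const (y := p)) (fun _ => hgl) fun _ => hgr)
      (((continuous_quaternionExtend hl.1).mul (continuous_quaternionExtend hr.1).star).comp
        (continuous_subtype_val.comp continuous_snd))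
      fun _ t ht => hasDerivWithinAt_mul_star hl hr hgl hgr hs ht
  obtain ⟨γ, hγ⟩ := exists_sphereCurve
    (linearIsometryEquivTuple.toContinuousLinearEquiv.contDiff.comp_contDiffOn (hsm.contDiffOn ()))
    fun t ht => by
      change ‖linearIsometryEquivTuple _‖ = 1
      rw [LinearIsometryEquiv.norm_map, norm_mul, norm_star, norm_quaternionExtend,
        norm_quaternionExtend, one_mul]
  have hall : ∀ t ∈ Icc (0 : ℝ) 1, (α t).imJ = 0 ∧ (β t).imJ = 0 ∧ (α t).imK = (β t).imK ∧
      0 < (α t).imK ∧ (β t).imI < (α t).imI := fun t ht =>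
    ⟨(h t ht).1, (h t ht).2.1, (h t ht).2.2.1, (h t ht).2.2.2.1, (abs_lt.1 (hlt t ht)).2⟩
  obtain ⟨hg, hF⟩ := (isGeneric_and_isFrenetFrame_spinProj4_iff hα hβ hγ).2 hall
  have hL : IsLiftedFrame spinProj4 γ (fun t => (Γl t, Γr t)) :=
    ⟨hl.1.prodMk hr.1, Prod.ext hl.2.1 hr.2.1, hF⟩
  refine ⟨γ, ⟨?_, _, hL, Prod.ext hl₁ hr₁⟩, Γl, Γr, hl, hr, hL, hl₁, hr₁⟩
  refine (isLocallyConvex_iff hg hF).2 fun t => ?_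
  have h₂ := (frenet_iff_of_isSpinCurve_pair hα hβ hγ).2 hall t t.2
  rw [euclideanCol_spinProj4, ← quaternionExtend_coe, ← quaternionExtend_coe]
  refine lt_of_lt_of_eq ?_ h₂.symm
  have h₃ := abs_lt.1 (hlt t t.2)
  exact mul_pos (by linarith) (mul_pos (by linarith [(hall t t.2).2.2.2.1]) (by linarith))

end

/-- The pair of curves depends continuously on the curve `γ` in `𝕊³`, being given by the
differential expressions `𝐭 γ̄` and `γ̄ 𝐭`. -/
theorem continuous_of_haveCommonLift_right {zl zr : UnitQuaternion}
    {Φ : LS3 zl zr → SphereCurve 2 × SphereCurve 2}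
    (h : ∀ γ : LS3 zl zr, HaveCommonLift zl zr γ.1 (Φ γ)) : Continuous Φ := by
  have hd₀ : ∀ γ : LS3 zl zr, ∀ t ∈ Icc (0 : ℝ) 1, γ.1.der 1 t ≠ 0 := fun γ t ht =>
    IsGeneric.der_one_ne_zero (m := 1) γ.2.1.isGeneric ht
  refine Continuous.prodMk (f := fun γ => (Φ γ).1) (g := fun γ => (Φ γ).2) ?_ ?_
  · exact continuous_iff_isSmoothFamily.2 ((isSmoothFamily_leftCurve continuous_subtype_val
      hd₀).congr fun γ t ht => ((h γ).extend_eq ht).1)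
  · exact continuous_iff_isSmoothFamily.2 ((isSmoothFamily_rightCurve continuous_subtype_val
      hd₀).congr fun γ t ht => ((h γ).extend_eq ht).2)

/-- The curve in `𝕊³` solves a linear differential equation whose coefficients depend continuously
on the pair. -/
theorem continuous_of_haveCommonLift_left {zl zr : UnitQuaternion}
    {Ψ : curvePairs zl zr → SphereCurve 3}
    (h : ∀ p : curvePairs zl zr, HaveCommonLift zl zr (Ψ p) p.1) : Continuous Ψ := by
  choose Γl Γr hl hr hL _ _ using h
  have hgl : ∀ p : curvePairs zl zr, p.1.1.IsGeneric := fun p => p.2.1.1.isGeneric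
  have hgr : ∀ p : curvePairs zl zr, p.1.2.IsGeneric := fun p => p.2.2.1.1
  set q : curvePairs zl zr → ℝ → ℍ[ℝ] := fun p t =>
    quaternionExtend (Γl p) t * star (quaternionExtend (Γr p) t) with hq
  have ha := isSmoothFamily_odeCoeff (continuous_subtype_val (p := (· ∈ curvePairs zl zr)))
    hgl hgr
  have hd : ∀ p, ∀ t ∈ Icc (0 : ℝ) 1,
      HasDerivWithinAt (q p) (odeCoeff p.1 t * q p t) (Icc 0 1) t := fun p t ht =>
    hasDerivWithinAt_mul_star (hl p) (hr p) (hgl p) (hgr p)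
      (fun s hs => (p.2.2.2 ⟨s, hs⟩).1) ht
  have hn : ∀ p, ∀ t ∈ Icc (0 : ℝ) 1, ‖q p t‖ = 1 := fun p t _ => by
    rw [hq, norm_mul, norm_star, norm_quaternionExtend, norm_quaternionExtend, one_mul]
  have h₀ : ∀ p, q p 0 = 1 := fun p => by
    have h₁ := quaternionExtend_coe (Γl p) 0
    have h₂ := quaternionExtend_coe (Γr p) 0
    rw [(hl p).2.1] at h₁
    rw [(hr p).2.1] at h₂
    change quaternionExtend (Γl p) 0 * star (quaternionExtend (Γr p) 0) = 1
    rw [show quaternionExtend (Γl p) 0 = 1 from h₁, show quaternionExtend (Γr p) 0 = 1 from h₂,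
      star_one, one_mul]
  have hqs : IsSmoothFamily q := IsSmoothFamily.of_linear_ode ha
    (continuous_of_linear_ode ha.continuous (fun p t _ => re_odeCoeff p.1 t) hn h₀ hd) hd
  exact continuous_iff_isSmoothFamily.2
    ((hqs.clm (linearIsometryEquivTuple.toContinuousLinearEquiv :
      ℍ[ℝ] →L[ℝ] EuclideanSpace ℝ (Fin 4))).congr fun p t ht => (hL p).extend_eq₃ ht)
end

theorem theorem4 (zl zr : UnitQuaternion) :
    ∃ Φ : LS3 zl zr ≃ₜ curvePairs zl zr,
      ∀ γ : LS3 zl zr, ∃ Γl Γr : unitInterval → UnitQuaternion,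
        SphereCurve.IsLiftedFrame spinProj3 (Φ γ).1.1 Γl ∧
        SphereCurve.IsLiftedFrame spinProj3 (Φ γ).1.2 Γr ∧
        SphereCurve.IsLiftedFrame spinProj4 γ.1 (fun t => (Γl t, Γr t)) := by
  choose Φ hΦ hΦR using fun γ : LS3 zl zr => exists_pair γ.2
  choose Ψ hΨ hΨR using fun p : curvePairs zl zr => exists_curve p.2
  refine ⟨{ toFun := fun γ => ⟨Φ γ, hΦ γ⟩
            invFun := fun p => ⟨Ψ p, hΨ p⟩
            left_inv := fun γ => Subtype.ext ((hΨR ⟨Φ γ, hΦ γ⟩).left_unique (hΦR γ))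
            right_inv := fun p => Subtype.ext ((hΦR ⟨Ψ p, hΨ p⟩).right_unique (hΨR p))
            continuous_toFun := (continuous_of_haveCommonLift_right hΦR).subtype_mk _
            continuous_invFun := (continuous_of_haveCommonLift_left hΨR).subtype_mk _ },
    fun γ => ?_⟩
  obtain ⟨Γl, Γr, hl, hr, h, -, -⟩ := hΦR γ
  exact ⟨Γl, Γr, hl, hr, h⟩
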